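/- Let $\bm X_1,\bm X_2,\dots$ be i.i.d. random vectors with distribution function $F$ supported on $[0,\infty)^d$. Let $F_n(\bm x)=\frac1n\sum_{i=1}^n\mathbb I\{\bm X_i\le\bm x\}$ (coordinatewise inequality) be the empirical c.d.f., and for $m\in\{1,2,\dots\}$ let $$F_{m,n}(\bm x)=\sum_{\bm k\in\mathbb N_0^d}F_n\Big(\frac{\bm k}{m}\Big)\prod_{j=1}^d e^{-mx_j}\frac{(mx_j)^{k_j}}{k_j!}$$ be the Szász–Mirakyan estimator with equal smoothing levels $m_1=\dots=m_d=m$. Assume that $F$ is twice continuously differentiable on $(0,\infty)^d$ and that, for every compact $K\subset(0,\infty)^d$, its first and second partial derivatives are bounded on $\{\bm y\in(0,\infty)^d:\exists \bm z\in K,\ \|\bm y-\bm z\|_1\le\delta_K\}$ for some $\delta_K>0$. Put $$\sigma^2(\bm x)=F(\bm x)\{1-F(\bm x)\},\qquad V(\bm x)=\sum_{j=1}^d\partial_{x_j}F(\bm x)\sqrt{x_j/\pi},\qquad B(\bm x)=\frac12\sum_{j=1}^d x_j\,\partial^2_{x_jx_j}F(\bm x).$$ For estimators of $F$ write $\mathrm{MSE}(T(\bm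 x))=\mathbb E[(T(\bm x)-F(\bm x))^2]$ and $\mathrm{IMSE}_S(T)=\int_S\mathrm{MSE}(T(\bm x))\,d\bm x$. Let $S\subset(0,\infty)^d$ be compact, let $m=m(n)\ge1$ be a sequence of integers, and define the local and global deficiencies $$L(n,\bm x)=\min\{k\ge1:\mathrm{MSE}(F_k(\bm x))\le\mathrm{MSE}(F_{m,n}(\bm x))\},\qquad G_S(n)=\min\{k\ge1:\mathrm{IMSE}_S(F_k)\le\mathrm{IMSE}_S(F_{m,n})\}.$$ (Local part.) Let $\bm x\in S$ with $0<F(\bm x)<1$, and set $D(n)=L(n,\bm x)$, $s=\sigma^2(\bm x)$, $v=V(\bm x)$, $b=B^2(\bm x)$. (Global part.) Suppose $\int_S\sigma^2(\bm x)\,d\bm x>0$, and set $D(n)=G_S(n)$, $s=\int_S\sigma^2(\bm x)\,d\bm x$, $v=\int_S V(\bm x)\,d\bm x$, $b=\int_S B^2(\bm x)\,d\bm x$. In each of the two parts the following holds as $n\to\infty$. - If $n\,m^{-2}\to0$, then $D(n)=n\{1+o(1)\}$. - (High-smoothing regime.) If $m\,n^{-2/3}\to\infty$ and $m\,n^{-2}\to0$,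 then $$D(n)-n=\frac{n}{m^{1/2}}\Big\{\frac vs+o(1)\Big\};$$ if moreover $v>0$, then $D(n)-n\to\infty$. - (Critical regime.) If $m\,n^{-2/3}\to c$ with $0<c<\infty$, then $$D(n)-n=n^{2/3}\Big\{c^{-1/2}\frac vs-c^{-2}\frac bs+o(1)\Big\};$$ if moreover $c^{-1/2}v/s-c^{-2}b/s>0$, then $D(n)-n\to\infty$. -/

import Mathlib

open MeasureTheory ProbabilityTheory Filter Topology

noncomputable section

namespace SzaszMirakyan

/-- The open orthant `(0,∞)^d`. -/
def posOrthant (d : ℕ) : Set (Fin d → ℝ) := {x | ∀ j, 0 < x j}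

/-- The (multivariate) cumulative distribution function of a law `μ` on `ℝ^d`:
`F(x) = μ {y | y ≤ x}`, the inequality being coordinatewise. -/
def distFun {d : ℕ} (μ : Measure (Fin d → ℝ)) (x : Fin d → ℝ) : ℝ := μ.real (Set.Iic x)

/-- First partial derivative `∂_{x_i} F`. -/
def partialDeriv {d : ℕ} (i : Fin d) (F : (Fin d → ℝ) → ℝ) (x : Fin d → ℝ) : ℝ :=
  fderiv ℝ F x (Pi.single i 1)

/-- The `ℓ¹`-neighbourhood of `S` of radius `δ` inside `(0,∞)^d`. -/
def tube {d : ℕ} (S : Set (Fin d → ℝ)) (δ : ℝ) : Set (Fin d → ℝ) :=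
  {y | y ∈ posOrthant d ∧ ∃ z ∈ S, ∑ j, |y j - z j| ≤ δ}

/-- The regularity assumption: `F` is `C²` on `(0,∞)^d`, and its first and second partial
derivatives are bounded on a neighbourhood of every compact subset of `(0,∞)^d`. -/
def RegularC2 {d : ℕ} (F : (Fin d → ℝ) → ℝ) : Prop :=
  ContDiffOn ℝ 2 F (posOrthant d) ∧
  ∀ S : Set (Fin d → ℝ), IsCompact S → S ⊆ posOrthant d →
    ∃ δ > 0, ∃ M : ℝ, ∀ y ∈ tube S δ,
      (∀ i, |partialDeriv i F y| ≤ M) ∧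
      (∀ i j, |partialDeriv i (partialDeriv j F) y| ≤ M)

/-- The product Poisson weight `P_{k,m}(x) = ∏_j exp(-m_j x_j) (m_j x_j)^{k_j} / k_j!`. -/
def poissonWeight {d : ℕ} (m k : Fin d → ℕ) (x : Fin d → ℝ) : ℝ :=
  ∏ j, Real.exp (-((m j : ℝ) * x j)) * ((m j : ℝ) * x j) ^ k j / ((k j).factorial : ℝ)

/-- The empirical c.d.f. of the observations `X 0, …, X (n - 1)`. -/
def empiricalCdf {d : ℕ} {Ω : Type*} (X : ℕ → Ω → Fin d → ℝ) (n : ℕ) (x : Fin d → ℝ) (ω : Ω) :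
    ℝ :=
  (n : ℝ)⁻¹ * ∑ i ∈ Finset.range n, Set.indicator (Set.Iic x) (fun _ => (1 : ℝ)) (X i ω)

/-- The Szász–Mirakyan estimator
`F_{m,n}(x) = ∑_{k ∈ ℕ₀^d} F_n(k_1/m_1, …, k_d/m_d) P_{k,m}(x)`. -/
def estimator {d : ℕ} {Ω : Type*} (X : ℕ → Ω → Fin d → ℝ) (m : Fin d → ℕ) (n : ℕ)
    (x : Fin d → ℝ) (ω : Ω) : ℝ :=
  ∑' k : Fin d → ℕ, empiricalCdf X n (fun j => (k j : ℝ) / (m j : ℝ)) ω * poissonWeight m k x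

/-- The mean squared error `E[(T - θ)²]` of an estimator `T` of the number `θ`. -/
def mse {Ω : Type*} [MeasurableSpace Ω] (P : Measure Ω) (T : Ω → ℝ) (θ : ℝ) : ℝ :=
  ∫ ω, (T ω - θ) ^ 2 ∂P

/-- The integrated mean squared error over `S` of an estimator `T` of the function `F`. -/
def imse {d : ℕ} {Ω : Type*} [MeasurableSpace Ω] (P : Measure Ω) (S : Set (Fin d → ℝ))
    (T : (Fin d → ℝ) → Ω → ℝ) (F : (Fin d → ℝ) → ℝ) : ℝ :=
  ∫ x in S, mse P (T x) (F x)

/-- The local deficiency at `x` of the empirical c.d.f. relative to the Szász–Mirakyan estimator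
with smoothing levels `m_1 = ⋯ = m_d = m` and sample size `n`: the least sample size `k ≥ 1` with
`MSE(F_k(x)) ≤ MSE(F_{m,n}(x))`. -/
def localDeficiency {d : ℕ} {Ω : Type*} [MeasurableSpace Ω] (P : Measure Ω)
    (X : ℕ → Ω → Fin d → ℝ) (F : (Fin d → ℝ) → ℝ) (m n : ℕ) (x : Fin d → ℝ) : ℕ :=
  sInf {k : ℕ | 1 ≤ k ∧
    mse P (empiricalCdf X k x) (F x) ≤ mse P (estimator X (fun _ => m) n x) (F x)}

/-- The global deficiency on `S`: the least sample size `k ≥ 1` with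
`IMSE_S(F_k) ≤ IMSE_S(F_{m,n})`. -/
def globalDeficiency {d : ℕ} {Ω : Type*} [MeasurableSpace Ω] (P : Measure Ω)
    (X : ℕ → Ω → Fin d → ℝ) (F : (Fin d → ℝ) → ℝ) (m n : ℕ) (S : Set (Fin d → ℝ)) : ℕ :=
  sInf {k : ℕ | 1 ≤ k ∧
    imse P S (empiricalCdf X k) F ≤ imse P S (estimator X (fun _ => m) n) F}

/-- `σ²(x) = F(x) (1 - F(x))`. -/
def sigmaSq {d : ℕ} (F : (Fin d → ℝ) → ℝ) (x : Fin d → ℝ) : ℝ := F x * (1 - F x)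

/-- `V(x) = ∑_j ∂_{x_j} F(x) √(x_j / π)`. -/
def V {d : ℕ} (F : (Fin d → ℝ) → ℝ) (x : Fin d → ℝ) : ℝ :=
  ∑ j, partialDeriv j F x * Real.sqrt (x j / Real.pi)

/-- `B(x) = ½ ∑_j x_j ∂²_{x_j x_j} F(x)`. -/
def B {d : ℕ} (F : (Fin d → ℝ) → ℝ) (x : Fin d → ℝ) : ℝ :=
  (1 / 2) * ∑ j, x j * partialDeriv j (partialDeriv j F) x

/-- The expansions for a deficiency sequence `D : ℕ → ℕ` under smoothing levels `m : ℕ → ℕ`,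
with constants `s` (for `σ²`), `v` (for `V`) and `b` (for `B²`). -/
def DeficiencyExpansions (D m : ℕ → ℕ) (s v b : ℝ) : Prop :=
  -- if `n m⁻² → 0`, then `D(n) = n {1 + o(1)}`
  (Tendsto (fun n : ℕ => (n : ℝ) / (m n : ℝ) ^ 2) atTop (𝓝 0) →
    Tendsto (fun n : ℕ => (D n : ℝ) / (n : ℝ)) atTop (𝓝 1)) ∧
  -- high-smoothing regime
  (Tendsto (fun n : ℕ => (m n : ℝ) * (n : ℝ) ^ (-(2 / 3) : ℝ)) atTop atTop →
    Tendsto (fun n : ℕ => (m n : ℝ) / (n : ℝ) ^ 2) atTop (𝓝 0) →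
    Tendsto (fun n : ℕ => ((D n : ℝ) - (n : ℝ)) / ((n : ℝ) / Real.sqrt (m n))) atTop
      (𝓝 (v / s)) ∧
    (0 < v → Tendsto (fun n : ℕ => (D n : ℝ) - (n : ℝ)) atTop atTop)) ∧
  -- critical regime
  (∀ c : ℝ, 0 < c →
    Tendsto (fun n : ℕ => (m n : ℝ) * (n : ℝ) ^ (-(2 / 3) : ℝ)) atTop (𝓝 c) →
    Tendsto (fun n : ℕ => ((D n : ℝ) - (n : ℝ)) / (n : ℝ) ^ (2 / 3 : ℝ)) atTop
      (𝓝 (c ^ (-(1 / 2) : ℝ) * (v / s) - c ^ (-2 : ℝ) * (b / s))) ∧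
    (0 < c ^ (-(1 / 2) : ℝ) * (v / s) - c ^ (-2 : ℝ) * (b / s) →
      Tendsto (fun n : ℕ => (D n : ℝ) - (n : ℝ)) atTop atTop))

end SzaszMirakyan

end

/-! Let `N`, `N'` be independent vectors with independent Poisson coordinates of means `m x_j`. The
estimator is the sample mean of the bounded kernel `h(y) = P(y ≤ N/m)`, and Fubini gives `E h(X) = E
F(N/m)` and `E h(X)² = E F(min(N, N')/m)`. Hence, exactly, `n · MSE = σ² - v_m/√m + n b_m²/m²`,
where `b_m` is the bias times `m` and `v_m` collects the variance terms (`mul_mse_estimator`).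

Since `N/m` has mean `x` and covariance `diag(x_j/m)`, a second-order Taylor expansion gives `b_m →
B` (`tendsto_scaledBias`). The minimum is not centred: `E min(N_j, N'_j)/m - x_j = -E|N_j -
N'_j|/(2m)`, which is of order `m^{-1/2}`, so a first-order expansion already gives `v_m → V`
(`tendsto_varianceGain`). The constant comes from `E|N_j - N'_j| ~ 2√(m x_j/π)`
(`tendsto_poissonMeanDiff`), obtained from characteristic functions through `∫₀^∞ (1 - cos ut)/u² du
= const · |t|`.

The empirical c.d.f. has MSE `s/k`, so the deficiency is `s/A` rounded up, with `A` the error of the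
smooth estimator. Thus `D - n = n (s - nA)/(nA) + O(1)`, and inserting the expansion of `nA` gives
all three regimes (`deficiencyExpansions_of_error`). For the global version the same identity is
integrated over `S`; bounds uniform on `S` allow dominated convergence. -/

namespace SzaszMirakyan

open scoped NNReal

/-! ### Moments of the Poisson law -/

section Poisson

lemma integrable_poissonMeasure_mul {r : ℝ≥0} {f : ℕ → ℝ}
    (hf : Integrable (fun n => f (n + 1)) (poissonMeasure r)) :
    Integrable (fun n : ℕ => (n : ℝ) * f n) (poissonMeasure r) := by
  rw [integrable_poissonMeasure_iff] at hf ⊢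
  rw [← summable_nat_add_iff 1]
  refine (hf.mul_left (r : ℝ)).congr fun n => ?_
  rw [Nat.factorial_succ, norm_mul, Real.norm_natCast]
  push_cast
  field_simp
  ring

/-- The Stein–Chen identity: the factor `n` cancels against `n!`, and shifting the summation index
releases one factor `r`. Every moment below follows from it. -/
lemma integral_poissonMeasure_mul {r : ℝ≥0} {f : ℕ → ℝ}
    (hf : Integrable (fun n => f (n + 1)) (poissonMeasure r)) :
    ∫ n, (n : ℝ) * f n ∂poissonMeasure r = r * ∫ n, f (n + 1) ∂poissonMeasure r := by
  have h1 := (hasSum_integral_poissonMeasure hf).mul_left (r : ℝ)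
  have h2 := hasSum_integral_poissonMeasure (integrable_poissonMeasure_mul hf)
  refine (h2.unique ?_)
  rw [← hasSum_nat_add_iff' 1]
  simp only [Finset.range_one, Finset.sum_singleton, Nat.cast_zero, zero_mul, smul_zero, sub_zero]
  refine h1.congr_fun fun n => ?_
  rw [Nat.factorial_succ, smul_eq_mul, smul_eq_mul]
  push_cast
  field_simp
  ring

lemma integrable_poissonMeasure_add_pow (r : ℝ≥0) (k : ℕ) (a : ℝ) :
    Integrable (fun n : ℕ => ((n : ℝ) + a) ^ k) (poissonMeasure r) := by
  -- The shift `n ↦ n + 1` turns `a` into `1 + a`, so the induction hypothesis is needed for every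
  -- `a`.
  induction k generalizing a with
  | zero => simp
  | succ k ih =>
    have h1 : Integrable (fun n : ℕ => (n : ℝ) * ((n : ℝ) + a) ^ k) (poissonMeasure r) := by
      refine integrable_poissonMeasure_mul (f := fun n : ℕ => ((n : ℝ) + a) ^ k) ?_
      refine (ih (1 + a)).congr (ae_of_all _ fun n => ?_)
      push_cast
      ring
    refine (h1.add ((ih a).const_mul a)).congr (ae_of_all _ fun n => ?_)
    simp only [Pi.add_apply]
    ring

lemma integral_poissonMeasure_add_pow_succ (r : ℝ≥0) (k : ℕ) (a : ℝ) :
    ∫ n, ((n : ℝ) + a) ^ (k + 1) ∂poissonMeasure r =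
      r * ∫ n, ((n : ℝ) + (a + 1)) ^ k ∂poissonMeasure r +
        a * ∫ n, ((n : ℝ) + a) ^ k ∂poissonMeasure r := by
  have h0 : Integrable (fun n : ℕ => (((n + 1 : ℕ) : ℝ) + a) ^ k) (poissonMeasure r) := by
    refine (integrable_poissonMeasure_add_pow r k (a + 1)).congr (ae_of_all _ fun n => ?_)
    push_cast
    ring
  have h1 := integral_poissonMeasure_mul (f := fun n : ℕ => ((n : ℝ) + a) ^ k) h0
  have h2 := integrable_poissonMeasure_mul (f := fun n : ℕ => ((n : ℝ) + a) ^ k) h0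
  have h3 : ∀ n : ℕ, ((n : ℝ) + a) ^ (k + 1) = (n : ℝ) * ((n : ℝ) + a) ^ k +
      a * ((n : ℝ) + a) ^ k := fun n => by ring
  simp_rw [h3]
  rw [integral_add h2 ((integrable_poissonMeasure_add_pow r k a).const_mul a), h1,
    integral_const_mul]
  congr 3
  ext n
  push_cast
  ring

lemma integrable_poissonMeasure_sub_pow (r : ℝ≥0) (k : ℕ) (a : ℝ) :
    Integrable (fun n : ℕ => ((n : ℝ) - a) ^ k) (poissonMeasure r) := by
  simpa [sub_eq_add_neg] using integrable_poissonMeasure_add_pow r k (-a)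

lemma integral_poissonMeasure_sub (r : ℝ≥0) :
    ∫ n, ((n : ℝ) - r) ∂poissonMeasure r = 0 := by
  have := integral_poissonMeasure_add_pow_succ r 0 (-r)
  simp only [zero_add, pow_one, pow_zero, integral_const, probReal_univ, smul_eq_mul] at this
  simp only [sub_eq_add_neg, this]
  ring

lemma integral_poissonMeasure_sub_sq (r : ℝ≥0) :
    ∫ n, ((n : ℝ) - r) ^ 2 ∂poissonMeasure r = r := by
  have h := fun k a => integral_poissonMeasure_add_pow_succ r k a
  have h0 : ∀ a : ℝ, ∫ n, ((n : ℝ) + a) ^ 0 ∂poissonMeasure r = 1 := by simp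
  simp only [sub_eq_add_neg]
  simp only [h 1, h 0, h0]
  ring

lemma integral_poissonMeasure_sub_pow_four (r : ℝ≥0) :
    ∫ n, ((n : ℝ) - r) ^ 4 ∂poissonMeasure r = 3 * (r : ℝ) ^ 2 + r := by
  have h := fun k a => integral_poissonMeasure_add_pow_succ r k a
  have h0 : ∀ a : ℝ, ∫ n, ((n : ℝ) + a) ^ 0 ∂poissonMeasure r = 1 := by simp
  simp only [sub_eq_add_neg]
  simp only [h 3, h 2, h 1, h 0, h0]
  ring

end Poisson

/-! ### Mean absolute difference of two Poisson variables -/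

section AbsMoment

/-- The constant `∫₀^∞ (1 - cos u) / u² du`. -/
noncomputable def cosConst : ℝ := ∫ u in Set.Ioi (0 : ℝ), (1 - Real.cos u) / u ^ 2

/-- Combines `1 - cos u ≤ u²/2` near the origin with `1 - cos u ≤ 2` at infinity. -/
lemma one_sub_cos_div_sq_le (u : ℝ) : (1 - Real.cos u) / u ^ 2 ≤ 3 * (1 + u ^ 2)⁻¹ := by
  have h1 := Real.one_sub_sq_div_two_le_cos (x := u)
  have h2 := Real.neg_one_le_cos u
  rcases eq_or_ne u 0 with rfl | hu
  · simp
  have : 0 < u ^ 2 := by positivity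
  rw [← div_eq_mul_inv, div_le_div_iff₀ this (by positivity)]
  nlinarith

lemma one_sub_cos_div_sq_nonneg (t u : ℝ) : 0 ≤ (1 - Real.cos t) / u ^ 2 :=
  div_nonneg (by linarith [Real.cos_le_one t]) (sq_nonneg _)

lemma integrable_one_sub_cos_div_sq : Integrable (fun u : ℝ => (1 - Real.cos u) / u ^ 2) := by
  refine (integrable_inv_one_add_sq.const_mul 3).mono'
    (by apply Measurable.aestronglyMeasurable; fun_prop) (ae_of_all _ fun u => ?_)
  rw [Real.norm_of_nonneg (one_sub_cos_div_sq_nonneg u u)]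
  exact one_sub_cos_div_sq_le u

/-- The value of the constant is never needed: it appears on both sides of the limit and cancels
once it is known to be nonzero. -/
lemma cosConst_pos : 0 < cosConst := by
  unfold cosConst
  rw [setIntegral_pos_iff_support_of_nonneg_ae
    (ae_of_all _ fun u => one_sub_cos_div_sq_nonneg u u)
    integrable_one_sub_cos_div_sq.integrableOn]
  refine lt_of_lt_of_le ?_ (measure_mono (s := Set.Ioo 0 1) ?_)
  · simp
  · intro u hu
    refine ⟨?_, hu.1⟩
    rw [Function.mem_support]
    have h1 : Real.cos u < 1 := by
      simpa using Real.cos_lt_cos_of_nonneg_of_le_pi le_rfl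
        (hu.2.le.trans (by linarith [Real.pi_gt_three])) hu.1
    exact (div_pos (by linarith) (pow_pos hu.1 2)).ne'

lemma integral_one_sub_cos_mul (t : ℝ) :
    IntegrableOn (fun u : ℝ => (1 - Real.cos (u * t)) / u ^ 2) (Set.Ioi 0) ∧
    ∫ u in Set.Ioi (0 : ℝ), (1 - Real.cos (u * t)) / u ^ 2 = cosConst * |t| := by
  rcases eq_or_ne t 0 with rfl | ht
  · simp
  have ht' : 0 < |t| := abs_pos.2 ht
  have h : ∀ u : ℝ, (1 - Real.cos (u * t)) / u ^ 2 =
      |t| ^ 2 * ((1 - Real.cos (|t| * u)) / (|t| * u) ^ 2) := by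
    intro u
    have : Real.cos (u * t) = Real.cos (|t| * u) := by
      rw [mul_comm]
      rcases abs_choice t with h | h <;> simp [h]
    rw [this]
    rcases eq_or_ne u 0 with rfl | hu
    · simp
    · field_simp
  simp_rw [h]
  constructor
  · exact ((integrable_one_sub_cos_div_sq.comp_mul_left' ht'.ne').const_mul _).integrableOn
  · rw [integral_const_mul,
      integral_comp_mul_left_Ioi (fun u => (1 - Real.cos u) / u ^ 2) 0 ht', mul_zero, smul_eq_mul]
    unfold cosConst
    field_simp

/-- Integrating the cosine representation of `|t|` at `t = Z` and exchanging integrals expresses the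
first absolute moment through the real part of the characteristic function. Convergence of
characteristic functions plus a majorant then yields convergence of `E|Z|`. -/
lemma cosConst_mul_integral_abs {Ω : Type*} [MeasurableSpace Ω] {P : Measure Ω}
    [IsProbabilityMeasure P] {Z : Ω → ℝ} (hZm : Measurable Z) (hZ : Integrable Z P) :
    cosConst * ∫ ω, |Z ω| ∂P =
      ∫ u in Set.Ioi (0 : ℝ), (1 - ∫ ω, Real.cos (u * Z ω) ∂P) / u ^ 2 := by
  have hint : Integrable (Function.uncurry fun (ω : Ω) (u : ℝ) =>
      (1 - Real.cos (u * Z ω)) / u ^ 2) (P.prod (volume.restrict (Set.Ioi 0))) := by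
    rw [integrable_prod_iff]
    · constructor
      · exact ae_of_all _ fun ω => (integral_one_sub_cos_mul (Z ω)).1
      · simp only [Function.uncurry]
        have : ∀ ω, ∫ u in Set.Ioi (0 : ℝ), ‖(1 - Real.cos (u * Z ω)) / u ^ 2‖ =
            cosConst * |Z ω| := fun ω => by
          rw [← (integral_one_sub_cos_mul (Z ω)).2]
          congr 1
          ext u
          exact Real.norm_of_nonneg (one_sub_cos_div_sq_nonneg _ _)
        simp_rw [this]
        exact hZ.abs.const_mul _
    · apply Measurable.aestronglyMeasurable
      unfold Function.uncurry
      fun_prop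
  rw [← integral_const_mul]
  simp_rw [← (integral_one_sub_cos_mul (Z _)).2]
  rw [integral_integral_swap hint]
  congr 1
  ext u
  have hc : Integrable (fun ω => Real.cos (u * Z ω)) P :=
    Integrable.of_bound (by fun_prop) 1 (ae_of_all _ fun ω => by
      simpa using Real.abs_cos_le_one _)
  rw [integral_div, integral_sub (integrable_const _) hc]
  simp

lemma charFun_map_eq_cos_add_sin {Ω : Type*} [MeasurableSpace Ω] {P : Measure Ω}
    [IsProbabilityMeasure P] {Z : Ω → ℝ} (hZ : Measurable Z) (t : ℝ) :
    charFun (P.map Z) t =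
      ((∫ ω, Real.cos (t * Z ω) ∂P : ℝ) : ℂ) + (∫ ω, Real.sin (t * Z ω) ∂P : ℝ) * Complex.I := by
  have hc : Integrable (fun ω => Real.cos (t * Z ω)) P :=
    Integrable.of_bound (by fun_prop) 1 (ae_of_all _ fun ω => Real.abs_cos_le_one _)
  have hs : Integrable (fun ω => Real.sin (t * Z ω)) P :=
    Integrable.of_bound (by fun_prop) 1 (ae_of_all _ fun ω => Real.abs_sin_le_one _)
  rw [charFun_apply_real, integral_map hZ.aemeasurable (by fun_prop), ← integral_complex_ofReal,
    ← integral_complex_ofReal, ← integral_mul_const,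
    ← integral_add hc.ofReal (hs.ofReal.mul_const _)]
  congr 1
  ext ω
  rw [← Complex.ofReal_mul, Complex.exp_mul_I]
  push_cast
  rfl

/-- The difference of two independent copies has characteristic function `φ · conj φ = |φ|²`. -/
lemma integral_cos_prod_sub {Ω : Type*} [MeasurableSpace Ω] {P : Measure Ω}
    [IsProbabilityMeasure P] {Z : Ω → ℝ} (hZ : Measurable Z) (t : ℝ) :
    ∫ p : Ω × Ω, Real.cos (t * (Z p.1 - Z p.2)) ∂P.prod P = ‖charFun (P.map Z) t‖ ^ 2 := by
  have hc : Integrable (fun ω => Real.cos (t * Z ω)) P :=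
    Integrable.of_bound (by fun_prop) 1 (ae_of_all _ fun ω => Real.abs_cos_le_one _)
  have hs : Integrable (fun ω => Real.sin (t * Z ω)) P :=
    Integrable.of_bound (by fun_prop) 1 (ae_of_all _ fun ω => Real.abs_sin_le_one _)
  rw [charFun_map_eq_cos_add_sin hZ, ← Complex.normSq_eq_norm_sq, Complex.normSq_add_mul_I]
  simp_rw [mul_sub, Real.cos_sub]
  rw [integral_add (hc.mul_prod hc) (hs.mul_prod hs),
    integral_prod_mul (fun ω => Real.cos (t * Z ω)) (fun ω => Real.cos (t * Z ω)),
    integral_prod_mul (fun ω => Real.sin (t * Z ω)) (fun ω => Real.sin (t * Z ω))]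
  ring

lemma integral_cos_poisson_sub (r : ℝ≥0) (t : ℝ) :
    ∫ p : ℕ × ℕ, Real.cos (t * ((p.1 : ℝ) - (p.2 : ℝ))) ∂(poissonMeasure r).prod (poissonMeasure r)
      = Real.exp (-(2 * r * (1 - Real.cos t))) := by
  rw [integral_cos_prod_sub (Z := fun n : ℕ => (n : ℝ)) (by fun_prop)]
  have := charFun_map_cast_poissonMeasure r t
  rw [this, Complex.norm_exp, ← Real.exp_nat_mul]
  congr 1
  simp [Complex.exp_ofReal_mul_I_re]
  ring

lemma integral_cos_gaussianReal (t : ℝ) :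
    ∫ z, Real.cos (t * z) ∂gaussianReal 0 2 = Real.exp (-t ^ 2) := by
  have h := charFun_gaussianReal (μ := 0) (v := 2) t
  have h2 := charFun_map_eq_cos_add_sin (P := gaussianReal 0 2) (Z := id) measurable_id t
  rw [Measure.map_id, h] at h2
  have h3 := congrArg Complex.re h2
  have h4 : (t : ℂ) * ((0 : ℝ) : ℂ) * Complex.I - ((2 : ℝ≥0) : ℝ) * (t : ℂ) ^ 2 / 2 =
      ((-t ^ 2 : ℝ) : ℂ) := by
    push_cast
    simp
  rw [h4, ← Complex.ofReal_exp, Complex.ofReal_re] at h3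
  simpa using h3.symm

lemma integral_abs_gaussianReal :
    ∫ z, |z| ∂gaussianReal 0 2 = 2 / Real.sqrt Real.pi := by
  rw [integral_gaussianReal_eq_integral_smul (by norm_num)]
  have h1 : ∀ z : ℝ, gaussianPDFReal 0 2 z • |z| =
      (fun y : ℝ => (2 * Real.sqrt Real.pi)⁻¹ * (y ^ (1 : ℝ) * Real.exp (-(1 / 4) * y ^ (2 : ℝ))))
        |z| := by
    intro z
    have h4 : Real.sqrt (2 * Real.pi * ((2 : ℝ≥0) : ℝ)) = 2 * Real.sqrt Real.pi := by
      rw [show 2 * Real.pi * ((2 : ℝ≥0) : ℝ) = 2 ^ 2 * Real.pi by push_cast; ring,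
        Real.sqrt_mul (by norm_num), Real.sqrt_sq (by norm_num)]
    simp only [gaussianPDFReal, h4, smul_eq_mul, Real.rpow_one, Real.rpow_two, sq_abs]
    rw [show -(z - 0) ^ 2 / (2 * ((2 : ℝ≥0) : ℝ)) = -(1 / 4) * z ^ 2 by push_cast; ring]
    ring
  rw [integral_congr_ae (ae_of_all _ h1), integral_comp_abs
      (f := fun y : ℝ => (2 * Real.sqrt Real.pi)⁻¹ *
        (y ^ (1 : ℝ) * Real.exp (-(1 / 4) * y ^ (2 : ℝ)))), integral_const_mul,
    integral_rpow_mul_exp_neg_mul_rpow (by norm_num) (by norm_num) (by norm_num)]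
  norm_num
  field_simp

/-- By the Taylor bound for the cosine the error is `O(w⁴/r)`. This is the exponent of the
characteristic function of `(N - N')/√r`, so the limit law is Gaussian with variance 2. -/
lemma tendsto_mul_one_sub_cos (w : ℝ) :
    Tendsto (fun r : ℝ => 2 * r * (1 - Real.cos (w / Real.sqrt r))) atTop (𝓝 (w ^ 2)) := by
  have h0 : Tendsto (fun r : ℝ => w / Real.sqrt r) atTop (𝓝 0) :=
    tendsto_const_nhds.div_atTop Real.tendsto_sqrt_atTop
  have h1 : Tendsto (fun r : ℝ => w ^ 4 * r⁻¹) atTop (𝓝 0) := by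
    simpa using tendsto_inv_atTop_zero.const_mul (w ^ 4)
  rw [tendsto_iff_norm_sub_tendsto_zero]
  refine squeeze_zero' (Eventually.of_forall fun _ => norm_nonneg _) ?_ h1
  have h2 : ∀ᶠ r : ℝ in atTop, |w / Real.sqrt r| < 1 := by
    have := h0.abs
    rw [abs_zero] at this
    exact this.eventually_lt_const one_pos
  filter_upwards [h2, eventually_gt_atTop 0] with r hr hr0
  have h3 := Real.cos_bound hr.le
  have hs : Real.sqrt r ^ 2 = r := Real.sq_sqrt hr0.le
  have h4 : (w / Real.sqrt r) ^ 2 = w ^ 2 / r := by rw [div_pow, hs]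
  have h5 : |w / Real.sqrt r| ^ 4 = w ^ 4 / r ^ 2 := by
    rw [← abs_pow, abs_of_nonneg (by positivity), div_pow,
      show Real.sqrt r ^ 4 = (Real.sqrt r ^ 2) ^ 2 by ring, hs]
  rw [h4, h5] at h3
  have h6 : 2 * r * (1 - Real.cos (w / Real.sqrt r)) - w ^ 2 =
      -(2 * r) * (Real.cos (w / Real.sqrt r) - (1 - w ^ 2 / r / 2)) := by
    field_simp
    ring
  rw [h6, Real.norm_eq_abs, abs_mul, abs_neg, abs_of_pos (by positivity : 0 < 2 * r)]
  calc 2 * r * |Real.cos (w / Real.sqrt r) - (1 - w ^ 2 / r / 2)|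
      ≤ 2 * r * (w ^ 4 / r ^ 2 * (5 / 96)) := by gcongr
    _ = (w ^ 4 * r⁻¹) * (10 / 96) := by field_simp; ring
    _ ≤ w ^ 4 * r⁻¹ := by
      have : 0 ≤ w ^ 4 * r⁻¹ := by positivity
      linarith

/-- The mean absolute difference of two independent Poisson variables of rate `r`. -/
noncomputable def poissonMeanDiff (r : ℝ≥0) : ℝ :=
  ∫ p : ℕ × ℕ, |(p.1 : ℝ) - (p.2 : ℝ)| ∂(poissonMeasure r).prod (poissonMeasure r)

lemma integrable_poisson_prod_sub (r : ℝ≥0) :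
    Integrable (fun p : ℕ × ℕ => (p.1 : ℝ) - (p.2 : ℝ))
      ((poissonMeasure r).prod (poissonMeasure r)) := by
  have h : Integrable (fun n : ℕ => (n : ℝ)) (poissonMeasure r) := by
    simpa using integrable_poissonMeasure_sub_pow r 1 0
  exact (h.comp_fst _).sub (h.comp_snd _)

lemma poissonMeanDiff_le (r : ℝ≥0) : poissonMeanDiff r ≤ 2 * Real.sqrt r := by
  have hi := integrable_poissonMeasure_sub_pow r 1 r
  simp only [pow_one] at hi
  have h1 : ∫ n : ℕ, |(n : ℝ) - r| ∂poissonMeasure r ≤ Real.sqrt r := by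
    rcases eq_or_ne r 0 with rfl | hr
    -- Rate zero is separate because the weighted inequality `|t| ≤ t²/(2√r) + √r/2` used below
    -- divides by `√r`.
    · have h := integral_poissonMeasure_mul (r := 0) (f := fun _ => 1) (by simp)
      simp at h ⊢
      exact h.le
    have hr' : 0 < Real.sqrt r := Real.sqrt_pos.2 (by positivity)
    have h2 := integrable_poissonMeasure_sub_pow r 2 r
    calc ∫ n : ℕ, |(n : ℝ) - r| ∂poissonMeasure r
        ≤ ∫ n : ℕ, ((2 * Real.sqrt r)⁻¹ * ((n : ℝ) - r) ^ 2 + Real.sqrt r / 2)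
            ∂poissonMeasure r := by
          refine integral_mono hi.abs ((h2.const_mul _).add (integrable_const _)) fun n => ?_
          dsimp only
          rw [← sq_abs ((n : ℝ) - r)]
          have := sq_nonneg (|(n : ℝ) - r| - Real.sqrt r)
          field_simp
          nlinarith
      _ = Real.sqrt r := by
          rw [integral_add (h2.const_mul _) (integrable_const _), integral_const_mul,
            integral_poissonMeasure_sub_sq]
          simp only [integral_const, probReal_univ, smul_eq_mul, one_mul]
          have hs : Real.sqrt r ^ 2 = r := Real.sq_sqrt r.2
          field_simp
          linarith
  calc poissonMeanDiff r ≤ ∫ p : ℕ × ℕ, (|(p.1 : ℝ) - r| + |(p.2 : ℝ) - r|)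
          ∂(poissonMeasure r).prod (poissonMeasure r) := by
        refine integral_mono (integrable_poisson_prod_sub r).abs
          ((hi.abs.comp_fst _).add (hi.abs.comp_snd _)) fun p => ?_
        dsimp only
        rw [abs_sub_comm (p.2 : ℝ)]
        exact abs_sub_le _ _ _
    _ ≤ 2 * Real.sqrt r := by
        rw [integral_add (hi.abs.comp_fst _) (hi.abs.comp_snd _),
          integral_fun_fst (fun n : ℕ => |(n : ℝ) - r|),
          integral_fun_snd (fun n : ℕ => |(n : ℝ) - r|)]
        simp only [probReal_univ, one_smul]
        linarith

lemma one_sub_exp_div_sq_le {y w : ℝ} (hy : 0 ≤ y) (hyw : y ≤ w ^ 2) :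
    ‖(1 - Real.exp (-y)) / w ^ 2‖ ≤ 3 * (1 + w ^ 2)⁻¹ := by
  have h1 : Real.exp (-y) ≤ 1 := Real.exp_le_one_iff.2 (by linarith)
  have h2 := Real.add_one_le_exp (-y)
  have h3 := Real.exp_pos (-y)
  rw [Real.norm_of_nonneg (div_nonneg (by linarith) (sq_nonneg _))]
  rcases eq_or_ne w 0 with rfl | hw
  · simp
  have : 0 < w ^ 2 := by positivity
  rw [← div_eq_mul_inv, div_le_div_iff₀ this (by positivity)]
  nlinarith

/-- After rescaling by `√r` the cosine transforms are `exp(-2r(1 - cos(w/√r)))`, which converge to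
`exp(-w²)`. The exponents are at most `w²` in absolute value, so `3/(1 + w²)` dominates, and the
limit is `E|Z|` for `Z` Gaussian with variance 2. -/
lemma tendsto_poissonMeanDiff {ι : Type*} {l : Filter ι} [l.IsCountablyGenerated] {r : ι → ℝ≥0}
    (hr : Tendsto (fun i => (r i : ℝ)) l atTop) :
    Tendsto (fun i => poissonMeanDiff (r i) / Real.sqrt (r i)) l
      (𝓝 (2 / Real.sqrt Real.pi)) := by
  have hk := cosConst_pos
  have key : Tendsto (fun i => cosConst * (poissonMeanDiff (r i) / Real.sqrt (r i))) l
      (𝓝 (cosConst * (2 / Real.sqrt Real.pi))) := by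
    have h1 : ∀ i, cosConst * (poissonMeanDiff (r i) / Real.sqrt (r i)) =
        ∫ w in Set.Ioi (0 : ℝ),
          (1 - Real.exp (-(2 * r i * (1 - Real.cos (w / Real.sqrt (r i)))))) / w ^ 2 := by
      intro i
      have h := cosConst_mul_integral_abs (P := (poissonMeasure (r i)).prod (poissonMeasure (r i)))
        (Z := fun p => ((p.1 : ℝ) - (p.2 : ℝ)) / Real.sqrt (r i)) (by fun_prop)
        ((integrable_poisson_prod_sub (r i)).div_const _)
      simp only [abs_div, abs_of_nonneg (Real.sqrt_nonneg _), integral_div] at h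
      rw [poissonMeanDiff, h]
      simp only [← integral_cos_poisson_sub, div_mul_eq_mul_div, mul_div_assoc]
    have h2 : cosConst * (2 / Real.sqrt Real.pi) =
        ∫ w in Set.Ioi (0 : ℝ), (1 - Real.exp (-w ^ 2)) / w ^ 2 := by
      rw [← integral_abs_gaussianReal, cosConst_mul_integral_abs (by fun_prop)]
      · simp_rw [integral_cos_gaussianReal]
      · exact (memLp_id_gaussianReal 1).integrable le_rfl
    simp_rw [h1, h2]
    refine tendsto_integral_filter_of_dominated_convergence (fun w => 3 * (1 + w ^ 2)⁻¹) ?_ ?_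
      (integrable_inv_one_add_sq.const_mul 3).integrableOn ?_
    · refine Eventually.of_forall fun i => Measurable.aestronglyMeasurable ?_
      fun_prop
    · filter_upwards [hr.eventually_gt_atTop 0] with i hi
      refine ae_of_all _ fun w => one_sub_exp_div_sq_le ?_ ?_
      · have := Real.cos_le_one (w / Real.sqrt (r i))
        have := (r i).2
        exact mul_nonneg (by positivity) (by linarith)
      · have h3 := Real.one_sub_sq_div_two_le_cos (x := w / Real.sqrt (r i))
        rw [div_pow, Real.sq_sqrt hi.le] at h3
        calc 2 * (r i : ℝ) * (1 - Real.cos (w / Real.sqrt (r i)))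
            ≤ 2 * r i * (w ^ 2 / r i / 2) := by gcongr; linarith
          _ = w ^ 2 := by field_simp
    · refine ae_of_all _ fun w => ?_
      exact ((((tendsto_mul_one_sub_cos w).comp hr).neg.rexp).const_sub 1).div_const _
  have := key.const_mul cosConst⁻¹
  simpa [← mul_assoc, hk.ne'] using this

end AbsMoment

/-! ### Product Poisson law and moments of the grid points -/

section ProductPoisson

variable {d : ℕ}

/-- The law of `d` independent Poisson variables with means `m x_j`. -/
noncomputable def poissonPi (m : ℕ) (x : Fin d → ℝ) : Measure (Fin d → ℕ) :=
  Measure.pi fun j => poissonMeasure (m * x j).toNNReal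

instance (m : ℕ) (x : Fin d → ℝ) : IsProbabilityMeasure (poissonPi m x) := by
  unfold poissonPi
  infer_instance

/-- The grid point `k / m`. -/
noncomputable def node (m : ℕ) (k : Fin d → ℕ) : Fin d → ℝ := fun j => (k j : ℝ) / m

lemma poissonPi_real_singleton (m : ℕ) {x : Fin d → ℝ} (hx : x ∈ posOrthant d) (k : Fin d → ℕ) :
    (poissonPi m x).real {k} = poissonWeight (fun _ => m) k x := by
  rw [measureReal_def, poissonPi, Measure.pi_singleton, ENNReal.toReal_prod, poissonWeight]
  refine Finset.prod_congr rfl fun j _ => ?_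
  rw [← measureReal_def, poissonMeasure_real_singleton,
    Real.coe_toNNReal _ (mul_nonneg (Nat.cast_nonneg _) (hx j).le)]

lemma integrable_of_bounded_discrete {α : Type*} [MeasurableSpace α] [DiscreteMeasurableSpace α]
    [Countable α] {ρ : Measure α} [IsFiniteMeasure ρ] {f : α → ℝ} {C : ℝ} (hf : ∀ a, |f a| ≤ C) :
    Integrable f ρ :=
  Integrable.of_bound (Measurable.of_discrete).aestronglyMeasurable C (ae_of_all _ hf)

lemma hasSum_poissonPi (m : ℕ) {x : Fin d → ℝ} (hx : x ∈ posOrthant d) {f : (Fin d → ℕ) → ℝ}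
    {C : ℝ} (hf : ∀ k, |f k| ≤ C) :
    HasSum (fun k => f k * poissonWeight (fun _ => m) k x) (∫ k, f k ∂poissonPi m x) := by
  have hi : Integrable f (poissonPi m x) := integrable_of_bounded_discrete hf
  have h := hasSum_integral_iUnion (μ := poissonPi m x) (s := fun k : Fin d → ℕ => {k})
    (fun k => measurableSet_singleton k) (fun i j hij => by simpa using hij) hi.integrableOn
  simp only [Set.iUnion_of_singleton, Measure.restrict_univ, integral_singleton,
    poissonPi_real_singleton m hx, smul_eq_mul] at h
  simpa only [mul_comm] using h

section Moments

variable {m : ℕ} {x : Fin d → ℝ}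

lemma node_sub_pow (hm : 1 ≤ m) (hx : x ∈ posOrthant d) (j : Fin d) (p : ℕ) (n : ℕ) :
    ((n : ℝ) / m - x j) ^ p = ((m : ℝ) ^ p)⁻¹ * ((n : ℝ) - (m * x j).toNNReal) ^ p := by
  have hm' : (m : ℝ) ≠ 0 := by positivity
  rw [Real.coe_toNNReal _ (mul_nonneg (Nat.cast_nonneg _) (hx j).le), ← inv_pow, ← mul_pow]
  congr 1
  field_simp

lemma integrable_node_sub_pow (hm : 1 ≤ m) (hx : x ∈ posOrthant d) (j : Fin d) (p : ℕ) :
    Integrable (fun k => (node m k j - x j) ^ p) (poissonPi m x) := by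
  refine integrable_comp_eval (X := fun _ => ℕ)
    (μ := fun j => poissonMeasure (m * x j).toNNReal) (i := j)
    (f := fun n : ℕ => ((n : ℝ) / m - x j) ^ p) ?_
  simp_rw [node_sub_pow hm hx]
  exact (integrable_poissonMeasure_sub_pow _ _ _).const_mul _

lemma integral_node_sub_pow (hm : 1 ≤ m) (hx : x ∈ posOrthant d) (j : Fin d) (p : ℕ) :
    ∫ k, (node m k j - x j) ^ p ∂poissonPi m x = ((m : ℝ) ^ p)⁻¹ *
      ∫ n, ((n : ℝ) - (m * x j).toNNReal) ^ p ∂poissonMeasure (m * x j).toNNReal := by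
  rw [← integral_const_mul]
  simp_rw [← node_sub_pow hm hx j p]
  exact integral_comp_eval (X := fun _ => ℕ)
    (μ := fun j => poissonMeasure (m * x j).toNNReal) (i := j)
    (f := fun n : ℕ => ((n : ℝ) / m - x j) ^ p)
    (Measurable.of_discrete).aestronglyMeasurable

lemma integrable_node_sub (hm : 1 ≤ m) (hx : x ∈ posOrthant d) (j : Fin d) :
    Integrable (fun k => node m k j - x j) (poissonPi m x) := by
  simpa using integrable_node_sub_pow hm hx j 1

lemma integral_node_sub (hm : 1 ≤ m) (hx : x ∈ posOrthant d) (j : Fin d) :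
    ∫ k, (node m k j - x j) ∂poissonPi m x = 0 := by
  have := integral_node_sub_pow hm hx j 1
  simp only [pow_one] at this
  rw [this, integral_poissonMeasure_sub, mul_zero]

lemma integral_node_sub_sq (hm : 1 ≤ m) (hx : x ∈ posOrthant d) (j : Fin d) :
    ∫ k, (node m k j - x j) ^ 2 ∂poissonPi m x = x j / m := by
  rw [integral_node_sub_pow hm hx, integral_poissonMeasure_sub_sq,
    Real.coe_toNNReal _ (mul_nonneg (Nat.cast_nonneg _) (hx j).le)]
  field_simp

lemma integral_node_sub_pow_four (hm : 1 ≤ m) (hx : x ∈ posOrthant d) (j : Fin d) :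
    ∫ k, (node m k j - x j) ^ 4 ∂poissonPi m x = 3 * x j ^ 2 / m ^ 2 + x j / m ^ 3 := by
  rw [integral_node_sub_pow hm hx, integral_poissonMeasure_sub_pow_four,
    Real.coe_toNNReal _ (mul_nonneg (Nat.cast_nonneg _) (hx j).le)]
  field_simp

lemma integrable_node_sub_mul (hm : 1 ≤ m) (hx : x ∈ posOrthant d) (i j : Fin d) :
    Integrable (fun k => (node m k i - x i) * (node m k j - x j)) (poissonPi m x) := by
  refine ((integrable_node_sub_pow hm hx i 2).add (integrable_node_sub_pow hm hx j 2)).mono'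
    (Measurable.of_discrete).aestronglyMeasurable (ae_of_all _ fun k => ?_)
  rw [Real.norm_eq_abs, abs_le, Pi.add_apply]
  constructor
  · nlinarith [sq_nonneg ((node m k i - x i) + (node m k j - x j)), sq_nonneg (node m k i - x i),
      sq_nonneg (node m k j - x j)]
  · nlinarith [sq_nonneg ((node m k i - x i) - (node m k j - x j)), sq_nonneg (node m k i - x i),
      sq_nonneg (node m k j - x j)]

lemma integral_node_sub_mul (hm : 1 ≤ m) (hx : x ∈ posOrthant d) (i j : Fin d) :
    ∫ k, (node m k i - x i) * (node m k j - x j) ∂poissonPi m x =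
      if i = j then x j / m else 0 := by
  split_ifs with hij
  · subst hij
    simp_rw [← pow_two]
    exact integral_node_sub_sq hm hx i
  · have h := (iIndepFun_pi (μ := fun j => poissonMeasure (m * x j).toNNReal)
      (X := fun j (n : ℕ) => (n : ℝ) / m - x j)
      (fun _ => (Measurable.of_discrete).aemeasurable)).indepFun hij
    have h2 := h.integral_fun_mul_eq_mul_integral (Measurable.of_discrete).aestronglyMeasurable
      (Measurable.of_discrete).aestronglyMeasurable
    have h3 := integral_node_sub hm hx i
    unfold poissonPi node at h3 ⊢
    rw [h2, h3, zero_mul]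

/-- The coordinatewise minimum of two grid points. -/
noncomputable def nodeMin (m : ℕ) (p : (Fin d → ℕ) × (Fin d → ℕ)) : Fin d → ℝ :=
  node m p.1 ⊓ node m p.2

/-- From `min(a, b) = (a + b)/2 - |a - b|/2`. The first two terms are centred, so the whole mean
displacement of the minimum comes from the absolute difference. -/
lemma nodeMin_sub (p : (Fin d → ℕ) × (Fin d → ℕ)) (j : Fin d) :
    nodeMin m p j - x j = (1 / 2) * (node m p.1 j - x j) + (1 / 2) * (node m p.2 j - x j) -
      (1 / (2 * m)) * |(p.1 j : ℝ) - p.2 j| := by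
  have h : |(p.1 j : ℝ) - p.2 j| / m = |node m p.1 j - node m p.2 j| := by
    rw [node, node, ← sub_div, abs_div, Nat.abs_cast]
  have h2 : 1 / (2 * (m : ℝ)) * |(p.1 j : ℝ) - p.2 j| = |node m p.1 j - node m p.2 j| / 2 := by
    rw [← h]
    ring
  rw [h2, nodeMin, Pi.inf_apply, inf_eq_half_smul_add_sub_abs_sub' ℝ]
  simp only [smul_eq_mul]
  rw [abs_sub_comm]
  ring

lemma measurePreserving_prod_eval (m : ℕ) (x : Fin d → ℝ) (j : Fin d) :
    MeasurePreserving (fun p : (Fin d → ℕ) × (Fin d → ℕ) => (p.1 j, p.2 j))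
      ((poissonPi m x).prod (poissonPi m x))
      ((poissonMeasure (m * x j).toNNReal).prod (poissonMeasure (m * x j).toNNReal)) :=
  (measurePreserving_eval _ j).prod (measurePreserving_eval _ j)

lemma integrable_abs_sub_eval (m : ℕ) (x : Fin d → ℝ) (j : Fin d) :
    Integrable (fun p : (Fin d → ℕ) × (Fin d → ℕ) => |(p.1 j : ℝ) - p.2 j|)
      ((poissonPi m x).prod (poissonPi m x)) :=
  (measurePreserving_prod_eval m x j).integrable_comp_of_integrable
    (integrable_poisson_prod_sub _).abs

lemma integral_abs_sub_eval (m : ℕ) (x : Fin d → ℝ) (j : Fin d) :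
    ∫ p : (Fin d → ℕ) × (Fin d → ℕ), |(p.1 j : ℝ) - p.2 j|
      ∂(poissonPi m x).prod (poissonPi m x) = poissonMeanDiff (m * x j).toNNReal := by
  rw [poissonMeanDiff, ← (measurePreserving_prod_eval m x j).map_eq,
    integral_map (Measurable.of_discrete).aemeasurable
      (Measurable.of_discrete).aestronglyMeasurable]

lemma integrable_nodeMin_sub (hm : 1 ≤ m) (hx : x ∈ posOrthant d) (j : Fin d) :
    Integrable (fun p => nodeMin m p j - x j) ((poissonPi m x).prod (poissonPi m x)) := by
  simp_rw [nodeMin_sub]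
  have h := integrable_node_sub hm hx j
  exact (((h.comp_fst _).const_mul _).add ((h.comp_snd _).const_mul _)).sub
    ((integrable_abs_sub_eval m x j).const_mul _)

lemma integral_nodeMin_sub (hm : 1 ≤ m) (hx : x ∈ posOrthant d) (j : Fin d) :
    ∫ p, (nodeMin m p j - x j) ∂(poissonPi m x).prod (poissonPi m x) =
      -(1 / (2 * m) * poissonMeanDiff (m * x j).toNNReal) := by
  simp_rw [nodeMin_sub]
  have h := integrable_node_sub hm hx j
  have h1 := (h.comp_fst (poissonPi m x)).const_mul (1 / 2)
  have h2 := (h.comp_snd (poissonPi m x)).const_mul (1 / 2)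
  have h3 : Integrable (fun p : (Fin d → ℕ) × (Fin d → ℕ) => 1 / 2 * (node m p.1 j - x j) +
      1 / 2 * (node m p.2 j - x j)) ((poissonPi m x).prod (poissonPi m x)) := h1.add h2
  rw [integral_sub h3 ((integrable_abs_sub_eval m x j).const_mul _), integral_add h1 h2,
    integral_const_mul, integral_const_mul, integral_const_mul, integral_abs_sub_eval,
    integral_fun_fst (fun k => node m k j - x j), integral_fun_snd (fun k => node m k j - x j),
    integral_node_sub hm hx]
  simp

lemma nodeMin_sub_sq_le (p : (Fin d → ℕ) × (Fin d → ℕ)) (j : Fin d) :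
    (nodeMin m p j - x j) ^ 2 ≤ (node m p.1 j - x j) ^ 2 + (node m p.2 j - x j) ^ 2 := by
  rw [nodeMin, Pi.inf_apply]
  rcases min_choice (node m p.1 j) (node m p.2 j) with h | h <;> rw [h]
  · linarith [sq_nonneg (node m p.2 j - x j)]
  · linarith [sq_nonneg (node m p.1 j - x j)]

lemma integrable_nodeMin_sub_sq (hm : 1 ≤ m) (hx : x ∈ posOrthant d) (j : Fin d) :
    Integrable (fun p => (nodeMin m p j - x j) ^ 2) ((poissonPi m x).prod (poissonPi m x)) := by
  have h := integrable_node_sub_pow hm hx j 2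
  refine ((h.comp_fst (poissonPi m x)).add (h.comp_snd (poissonPi m x))).mono'
    (Measurable.of_discrete).aestronglyMeasurable (ae_of_all _ fun p => ?_)
  rw [Real.norm_of_nonneg (sq_nonneg _)]
  exact nodeMin_sub_sq_le p j

lemma integral_nodeMin_sub_sq_le (hm : 1 ≤ m) (hx : x ∈ posOrthant d) (j : Fin d) :
    ∫ p, (nodeMin m p j - x j) ^ 2 ∂(poissonPi m x).prod (poissonPi m x) ≤ 2 * (x j / m) := by
  have h := integrable_node_sub_pow hm hx j 2
  have h1 := h.comp_fst (poissonPi m x)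
  have h2 := h.comp_snd (poissonPi m x)
  refine (integral_mono (integrable_nodeMin_sub_sq hm hx j) (h1.add h2)
    fun p => nodeMin_sub_sq_le p j).trans_eq ?_
  simp only [Pi.add_apply]
  rw [integral_add h1 h2, integral_fun_fst (fun k => (node m k j - x j) ^ 2),
    integral_fun_snd (fun k => (node m k j - x j) ^ 2), integral_node_sub_sq hm hx]
  simp
  ring

end Moments

end ProductPoisson

/-! ### Taylor bounds valid on the whole space -/

section Taylor

variable {d : ℕ}

lemma norm_sq_le_sum_sq (v : Fin d → ℝ) : ‖v‖ ^ 2 ≤ ∑ j, v j ^ 2 := by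
  have h0 : 0 ≤ ∑ j, v j ^ 2 := Finset.sum_nonneg fun j _ => sq_nonneg _
  have h : ‖v‖ ≤ Real.sqrt (∑ j, v j ^ 2) := by
    rw [pi_norm_le_iff_of_nonneg (Real.sqrt_nonneg _)]
    intro j
    rw [Real.norm_eq_abs, ← Real.sqrt_sq_eq_abs]
    exact Real.sqrt_le_sqrt
      (Finset.single_le_sum (f := fun j => v j ^ 2) (fun j _ => sq_nonneg _) (Finset.mem_univ j))
  calc ‖v‖ ^ 2 ≤ Real.sqrt (∑ j, v j ^ 2) ^ 2 := by gcongr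
    _ = _ := Real.sq_sqrt h0

lemma norm_pow_four_le_sum (v : Fin d → ℝ) : ‖v‖ ^ 4 ≤ d * ∑ j, v j ^ 4 := by
  calc ‖v‖ ^ 4 = (‖v‖ ^ 2) ^ 2 := by ring
    _ ≤ (∑ j, v j ^ 2) ^ 2 := by gcongr; exact norm_sq_le_sum_sq v
    _ ≤ (Finset.univ : Finset (Fin d)).card * ∑ j, (v j ^ 2) ^ 2 := sq_sum_le_card_mul_sum_sq
    _ = d * ∑ j, v j ^ 4 := by simp [← pow_mul]

lemma isOpen_posOrthant : IsOpen (posOrthant d) := by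
  have : posOrthant d = ⋂ j, {x | 0 < x j} := by
    ext x
    simp [posOrthant]
  rw [this]
  exact isOpen_iInter_of_finite fun j => isOpen_lt continuous_const (continuous_apply j)

lemma clm_apply_eq_sum (L : (Fin d → ℝ) →L[ℝ] ℝ) (v : Fin d → ℝ) :
    L v = ∑ j, v j * L (Pi.single j 1) := by
  conv_lhs => rw [pi_eq_sum_univ' v]
  rw [map_sum]
  refine Finset.sum_congr rfl fun j _ => ?_
  rw [map_smul, smul_eq_mul]

variable {F : (Fin d → ℝ) → ℝ}

lemma fderiv_apply_eq_sum (x v : Fin d → ℝ) :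
    fderiv ℝ F x v = ∑ j, v j * partialDeriv j F x :=
  clm_apply_eq_sum _ v

lemma differentiableAt_fderiv (hF : ContDiffOn ℝ 2 F (posOrthant d)) {x : Fin d → ℝ}
    (hx : x ∈ posOrthant d) : DifferentiableAt ℝ (fderiv ℝ F) x :=
  ((hF.fderiv_of_isOpen isOpen_posOrthant (m := 1) (by norm_num)).differentiableOn
    (by norm_num)).differentiableAt (isOpen_posOrthant.mem_nhds hx)

lemma continuousOn_fderiv (hF : ContDiffOn ℝ 2 F (posOrthant d)) :
    ContinuousOn (fderiv ℝ F) (posOrthant d) :=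
  hF.continuousOn_fderiv_of_isOpen isOpen_posOrthant (by norm_num)

lemma continuousOn_fderiv_fderiv (hF : ContDiffOn ℝ 2 F (posOrthant d)) :
    ContinuousOn (fderiv ℝ (fderiv ℝ F)) (posOrthant d) :=
  (hF.fderiv_of_isOpen isOpen_posOrthant (m := 1) (by norm_num)).continuousOn_fderiv_of_isOpen
    isOpen_posOrthant (by norm_num)

lemma differentiableAt_of_contDiffOn (hF : ContDiffOn ℝ 2 F (posOrthant d)) {x : Fin d → ℝ}
    (hx : x ∈ posOrthant d) : DifferentiableAt ℝ F x :=
  (hF.differentiableOn (by norm_num)).differentiableAt (isOpen_posOrthant.mem_nhds hx)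

lemma partialDeriv_partialDeriv (hF : ContDiffOn ℝ 2 F (posOrthant d)) {x : Fin d → ℝ}
    (hx : x ∈ posOrthant d) (i j : Fin d) :
    partialDeriv i (partialDeriv j F) x =
      fderiv ℝ (fderiv ℝ F) x (Pi.single i 1) (Pi.single j 1) := by
  have h := (differentiableAt_fderiv hF hx).hasFDerivAt.clm_apply
    (hasFDerivAt_const (Pi.single j 1 : Fin d → ℝ) x)
  have h2 : fderiv ℝ (partialDeriv j F) x = _ := HasFDerivAt.fderiv h
  rw [partialDeriv, h2]
  simp

/-- The grid points are unbounded and may lie on the boundary of the orthant, so the bound must hold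
for every `y`. Near `x` the second derivative is bounded on a compact thickening of `S`; away from
`x`, `|F| ≤ 1` and `‖y - x‖ > δ` let the quadratic absorb everything. -/
lemma exists_taylor_one_bound (hF : ContDiffOn ℝ 2 F (posOrthant d)) (hF1 : ∀ x, |F x| ≤ 1)
    {S : Set (Fin d → ℝ)} (hS : IsCompact S) (hSpos : S ⊆ posOrthant d) :
    ∃ C, 0 ≤ C ∧ ∀ x ∈ S, ∀ y, |F y - F x - fderiv ℝ F x (y - x)| ≤ C * ∑ j, (y j - x j) ^ 2 := by
  obtain ⟨δ, hδ, hK⟩ := hS.exists_cthickening_subset_open isOpen_posOrthant hSpos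
  have hKc : IsCompact (Metric.cthickening δ S) := hS.cthickening
  obtain ⟨M, hM⟩ := hKc.exists_bound_of_continuousOn
    (f := fderiv ℝ (fderiv ℝ F)) ((continuousOn_fderiv_fderiv hF).mono hK)
  obtain ⟨M', hM'⟩ := hS.exists_bound_of_continuousOn (f := fderiv ℝ F)
    ((continuousOn_fderiv hF).mono hSpos)
  -- `|M|` serves the near case; `2/δ²` and `|M'|/δ` absorb the increment of `F` and the linear term
  -- in the far case. Absolute values keep the constant nonnegative even for empty `S`.
  refine ⟨|M| + (2 / δ ^ 2 + |M'| / δ), by positivity, fun x hx y => ?_⟩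
  refine le_trans ?_ (mul_le_mul_of_nonneg_left (norm_sq_le_sum_sq (y - x)) (by positivity))
  rw [add_mul]
  rcases le_or_gt ‖y - x‖ δ with hy | hy
  · have hball : Metric.closedBall x ‖y - x‖ ⊆ Metric.cthickening δ S := fun z hz =>
      Metric.mem_cthickening_of_dist_le z x δ S hx ((Metric.mem_closedBall.1 hz).trans hy)
    have hxm : x ∈ Metric.closedBall x ‖y - x‖ := Metric.mem_closedBall_self (norm_nonneg _)
    have hym : y ∈ Metric.closedBall x ‖y - x‖ := by simp [dist_eq_norm]
    have hb : ∀ z ∈ Metric.closedBall x ‖y - x‖, ‖fderiv ℝ F z - fderiv ℝ F x‖ ≤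
        |M| * ‖y - x‖ := by
      intro z hz
      have h1 := (convex_closedBall x ‖y - x‖).norm_image_sub_le_of_norm_fderiv_le
        (fun w hw => differentiableAt_fderiv hF (hK (hball hw)))
        (fun w hw => (hM w (hball hw)).trans (le_abs_self M)) hxm hz
      refine h1.trans (mul_le_mul_of_nonneg_left ?_ (abs_nonneg _))
      rw [← dist_eq_norm]
      exact hz
    have h2 := (convex_closedBall x ‖y - x‖).norm_image_sub_le_of_norm_fderiv_le'
      (fun w hw => differentiableAt_of_contDiffOn hF (hK (hball hw))) hb hxm hym
    have h3 : 0 ≤ (2 / δ ^ 2 + |M'| / δ) * ‖y - x‖ ^ 2 := by positivity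
    rw [Real.norm_eq_abs] at h2
    calc _ ≤ _ := h2
      _ = |M| * ‖y - x‖ ^ 2 := by ring
      _ ≤ _ := by linarith
  · have h1 : |fderiv ℝ F x (y - x)| ≤ |M'| * ‖y - x‖ :=
      ((fderiv ℝ F x).le_opNorm _).trans
        (mul_le_mul_of_nonneg_right ((hM' x hx).trans (le_abs_self _)) (norm_nonneg _))
    have h2 : 1 ≤ ‖y - x‖ / δ := by rw [le_div_iff₀ hδ]; linarith
    have h3 : |F y - F x - fderiv ℝ F x (y - x)| ≤ 2 + |M'| * ‖y - x‖ := by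
      refine (abs_sub _ _).trans (add_le_add ((abs_sub _ _).trans ?_) h1)
      linarith [hF1 x, hF1 y]
    have h4 : 2 ≤ 2 / δ ^ 2 * ‖y - x‖ ^ 2 := by
      have : 2 / δ ^ 2 * ‖y - x‖ ^ 2 = 2 * (‖y - x‖ / δ) ^ 2 := by field_simp
      nlinarith
    have h5 : |M'| * ‖y - x‖ ≤ |M'| / δ * ‖y - x‖ ^ 2 := by
      have : |M'| / δ * ‖y - x‖ ^ 2 = |M'| * ‖y - x‖ * (‖y - x‖ / δ) := by field_simp
      rw [this]
      exact le_mul_of_one_le_right (by positivity) h2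
    have h6 : 0 ≤ |M| * ‖y - x‖ ^ 2 := by positivity
    linarith

/-- Differentiability of `fderiv ℝ F` at `x` gives a remainder `ε‖y - x‖²` in a small ball; outside
it, fourth powers absorb the rest. Fourth central moments of `N/m` are `O(m⁻²)`, so after
multiplication by `m` only the `ε` term survives. -/
lemma exists_taylor_two_bound (hF : ContDiffOn ℝ 2 F (posOrthant d)) (hF1 : ∀ x, |F x| ≤ 1)
    {x : Fin d → ℝ} (hx : x ∈ posOrthant d) {ε : ℝ} (hε : 0 < ε) :
    ∃ C, 0 ≤ C ∧ ∀ y, |F y - F x - fderiv ℝ F x (y - x) -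
      (1 / 2) * fderiv ℝ (fderiv ℝ F) x (y - x) (y - x)| ≤
        ε * ∑ j, (y j - x j) ^ 2 + C * ∑ j, (y j - x j) ^ 4 := by
  set A := fderiv ℝ (fderiv ℝ F) x with hA
  set L := fderiv ℝ F x with hL
  -- Symmetry makes `A (z - x)` the derivative of the quadratic form. The mean value inequality is
  -- then applied to `F` minus that form.
  have hsymm : ∀ v w, A v w = A w v :=
    (hF.contDiffAt (isOpen_posOrthant.mem_nhds hx)).isSymmSndFDerivAt (by simp)
  have hlo := (differentiableAt_fderiv hF hx).hasFDerivAt.isLittleO.def hε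
  obtain ⟨δ, hδ, hball⟩ := Metric.nhds_basis_closedBall.eventually_iff.1
    (hlo.and (isOpen_posOrthant.mem_nhds hx))
  have hQ : ∀ z, HasFDerivAt (fun y => (1 / 2 : ℝ) * A (y - x) (y - x)) (A (z - x)) z := by
    intro z
    have h0 : HasFDerivAt (fun y : Fin d → ℝ => y - x) (ContinuousLinearMap.id ℝ _) z :=
      (hasFDerivAt_id z).sub_const x
    have h1 := ((A.hasFDerivAt.comp z h0).clm_apply h0).const_mul (1 / 2 : ℝ)
    convert! h1 using 1
    ext w
    simp [hsymm w]
    ring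
  set C := 2 / δ ^ 4 + ‖L‖ / δ ^ 3 + ‖A‖ / (2 * δ ^ 2) with hC
  have hC0 : 0 ≤ C := by positivity
  refine ⟨C * d, by positivity, fun y => ?_⟩
  have hn2 := mul_le_mul_of_nonneg_left (norm_sq_le_sum_sq (y - x)) hε.le
  have hn4 := mul_le_mul_of_nonneg_left (norm_pow_four_le_sum (y - x)) hC0
  simp only [Pi.sub_apply] at hn2 hn4
  suffices h : |F y - F x - L (y - x) - (1 / 2) * A (y - x) (y - x)| ≤
      ε * ‖y - x‖ ^ 2 + C * ‖y - x‖ ^ 4 by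
    rw [mul_assoc]
    linarith
  rcases le_or_gt ‖y - x‖ δ with hy | hy
  · have hxm : x ∈ Metric.closedBall x ‖y - x‖ := Metric.mem_closedBall_self (norm_nonneg _)
    have hym : y ∈ Metric.closedBall x ‖y - x‖ := by simp [dist_eq_norm]
    have hsub : ∀ z ∈ Metric.closedBall x ‖y - x‖, z ∈ Metric.closedBall x δ := fun z hz =>
      Metric.closedBall_subset_closedBall hy hz
    have h2 := (convex_closedBall x ‖y - x‖).norm_image_sub_le_of_norm_hasFDerivWithin_le'
      (f := fun y => F y - (1 / 2 : ℝ) * A (y - x) (y - x))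
      (f' := fun z => fderiv ℝ F z - A (z - x)) (φ := L) (C := ε * ‖y - x‖)
      (fun z hz => ((differentiableAt_of_contDiffOn hF (hball (hsub z hz)).2).hasFDerivAt.sub
        (hQ z)).hasFDerivWithinAt) (fun z hz => ?_) hxm hym
    · have h3 : 0 ≤ C * ‖y - x‖ ^ 4 := by positivity
      rw [Real.norm_eq_abs] at h2
      simp only [sub_self, map_zero, mul_zero, sub_zero] at h2
      calc _ = |F y - 1 / 2 * A (y - x) (y - x) - F x - L (y - x)| := by congr 1; ring
        _ ≤ _ := h2
        _ = ε * ‖y - x‖ ^ 2 := by ring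
        _ ≤ _ := by linarith
    · have h4 := (hball (hsub z hz)).1
      rw [sub_right_comm]
      refine h4.trans (mul_le_mul_of_nonneg_left ?_ hε.le)
      rw [← dist_eq_norm]
      exact hz
  · have h1 : |L (y - x)| ≤ ‖L‖ * ‖y - x‖ := L.le_opNorm _
    have h1' : |A (y - x) (y - x)| ≤ ‖A‖ * ‖y - x‖ * ‖y - x‖ := A.le_opNorm₂ _ _
    have h2 : 1 ≤ ‖y - x‖ / δ := by rw [le_div_iff₀ hδ]; linarith
    have h3 : |F y - F x - L (y - x) - (1 / 2) * A (y - x) (y - x)| ≤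
        2 + ‖L‖ * ‖y - x‖ + ‖A‖ / 2 * ‖y - x‖ ^ 2 := by
      refine (abs_sub _ _).trans (add_le_add ((abs_sub _ _).trans
        (add_le_add ((abs_sub _ _).trans ?_) h1)) ?_)
      · linarith [hF1 x, hF1 y]
      · rw [abs_mul, abs_of_nonneg (by norm_num : (0 : ℝ) ≤ 1 / 2)]
        linarith
    have e4 : C * ‖y - x‖ ^ 4 = 2 * (‖y - x‖ / δ) ^ 4 + ‖L‖ * ‖y - x‖ * (‖y - x‖ / δ) ^ 3 +
        ‖A‖ / 2 * ‖y - x‖ ^ 2 * (‖y - x‖ / δ) ^ 2 := by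
      rw [hC]
      field_simp
    have i4 : 2 ≤ 2 * (‖y - x‖ / δ) ^ 4 := by
      have := one_le_pow₀ h2 (n := 4)
      linarith
    have i3 := le_mul_of_one_le_right (by positivity : 0 ≤ ‖L‖ * ‖y - x‖)
      (one_le_pow₀ h2 (n := 3))
    have i2 := le_mul_of_one_le_right (by positivity : 0 ≤ ‖A‖ / 2 * ‖y - x‖ ^ 2)
      (one_le_pow₀ h2 (n := 2))
    have : 0 ≤ ε * ‖y - x‖ ^ 2 := by positivity
    linarith

/-- Applied twice: to `node`, whose first central moments vanish, and to `nodeMin`, whose first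
moments carry the main term. -/
lemma abs_integral_sub_sum_le {α : Type*} [MeasurableSpace α] [DiscreteMeasurableSpace α]
    [Countable α] {ρ : Measure α} [IsProbabilityMeasure ρ] (hF1 : ∀ x, |F x| ≤ 1)
    {C : ℝ} {x : Fin d → ℝ}
    (hC : ∀ y, |F y - F x - fderiv ℝ F x (y - x)| ≤ C * ∑ j, (y j - x j) ^ 2)
    {Y : α → Fin d → ℝ} (h1 : ∀ j, Integrable (fun a => Y a j - x j) ρ)
    (h2 : ∀ j, Integrable (fun a => (Y a j - x j) ^ 2) ρ) :
    |∫ a, F (Y a) ∂ρ - F x - ∑ j, (∫ a, (Y a j - x j) ∂ρ) * partialDeriv j F x| ≤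
      C * ∑ j, ∫ a, (Y a j - x j) ^ 2 ∂ρ := by
  have hi : Integrable (fun a => F (Y a)) ρ := integrable_of_bounded_discrete fun a => hF1 _
  have hs : Integrable (fun a => ∑ j, (Y a j - x j) * partialDeriv j F x) ρ :=
    integrable_finsetSum _ fun j _ => (h1 j).mul_const _
  have hq : Integrable (fun a => C * ∑ j, (Y a j - x j) ^ 2) ρ :=
    (integrable_finsetSum _ fun j _ => h2 j).const_mul _
  have hd : Integrable (fun a => F (Y a) - F x) ρ := hi.sub (integrable_const _)
  have e1 : ∫ a, F (Y a) ∂ρ - F x - ∑ j, (∫ a, (Y a j - x j) ∂ρ) * partialDeriv j F x =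
      ∫ a, (F (Y a) - F x - fderiv ℝ F x (Y a - x)) ∂ρ := by
    simp_rw [fderiv_apply_eq_sum, Pi.sub_apply]
    rw [integral_sub hd hs, integral_sub hi (integrable_const _),
      integral_finsetSum _ fun j _ => (h1 j).mul_const _]
    simp [integral_mul_const]
  rw [e1]
  calc |∫ a, (F (Y a) - F x - fderiv ℝ F x (Y a - x)) ∂ρ|
      ≤ ∫ a, C * ∑ j, (Y a j - x j) ^ 2 ∂ρ := by
        rw [← Real.norm_eq_abs]
        exact norm_integral_le_of_norm_le hq (ae_of_all _ fun a => hC (Y a))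
    _ = _ := by rw [integral_const_mul, integral_finsetSum _ fun j _ => h2 j]

end Taylor

/-! ### Bias and second moment with explicit remainders -/

section Expansions

variable {d : ℕ} {F : (Fin d → ℝ) → ℝ}

/-- The mean `E F(N / m)` of the Szász–Mirakyan estimator. -/
noncomputable def smoothMean (F : (Fin d → ℝ) → ℝ) (m : ℕ) (x : Fin d → ℝ) : ℝ :=
  ∫ k, F (node m k) ∂poissonPi m x

/-- The second moment `E F(min(N, N') / m)` of a summand of the Szász–Mirakyan estimator. -/
noncomputable def smoothSecond (F : (Fin d → ℝ) → ℝ) (m : ℕ) (x : Fin d → ℝ) : ℝ :=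
  ∫ p, F (nodeMin m p) ∂(poissonPi m x).prod (poissonPi m x)

/-- The bias of the Szász–Mirakyan estimator, multiplied by `m`. -/
noncomputable def scaledBias (F : (Fin d → ℝ) → ℝ) (m : ℕ) (x : Fin d → ℝ) : ℝ :=
  m * (smoothMean F m x - F x)

/-- The decrease of the second moment caused by smoothing, multiplied by `√m`. -/
noncomputable def scaledGain (F : (Fin d → ℝ) → ℝ) (m : ℕ) (x : Fin d → ℝ) : ℝ :=
  Real.sqrt m * (F x - smoothSecond F m x)

lemma abs_scaledBias_le_of {m : ℕ} {x : Fin d → ℝ} (hm : 1 ≤ m) (hx : x ∈ posOrthant d)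
    (hF1 : ∀ x, |F x| ≤ 1) {C : ℝ}
    (hC : ∀ y, |F y - F x - fderiv ℝ F x (y - x)| ≤ C * ∑ j, (y j - x j) ^ 2) :
    |scaledBias F m x| ≤ C * ∑ j, x j := by
  have h := abs_integral_sub_sum_le (ρ := poissonPi m x) (Y := node m) hF1 hC
    (integrable_node_sub hm hx) fun j => integrable_node_sub_pow hm hx j 2
  simp only [integral_node_sub hm hx, integral_node_sub_sq hm hx, zero_mul,
    Finset.sum_const_zero, sub_zero, ← Finset.sum_div] at h
  have hm' : (0 : ℝ) < m := by positivity
  rw [scaledBias, smoothMean, abs_mul, abs_of_pos hm']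
  calc (m : ℝ) * _ ≤ m * (C * ((∑ j, x j) / m)) := by gcongr
    _ = _ := by field_simp

/-- The remainder is `√m` times a second moment of order `1/m`. The main term is written with the
ratio `E|N - N'|/√r` whose limit is `tendsto_poissonMeanDiff`. -/
lemma abs_scaledGain_sub_le {m : ℕ} {x : Fin d → ℝ} (hm : 1 ≤ m) (hx : x ∈ posOrthant d)
    (hF1 : ∀ x, |F x| ≤ 1) {C : ℝ} (hC0 : 0 ≤ C)
    (hC : ∀ y, |F y - F x - fderiv ℝ F x (y - x)| ≤ C * ∑ j, (y j - x j) ^ 2) :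
    |scaledGain F m x - ∑ j, partialDeriv j F x *
      (poissonMeanDiff (m * x j).toNNReal / Real.sqrt (m * x j) * (Real.sqrt (x j) / 2))| ≤
      2 * C * (∑ j, x j) / Real.sqrt m := by
  have h := abs_integral_sub_sum_le (ρ := (poissonPi m x).prod (poissonPi m x)) (Y := nodeMin m)
    hF1 hC (integrable_nodeMin_sub hm hx) (integrable_nodeMin_sub_sq hm hx)
  have h2 : C * ∑ j, ∫ a, (nodeMin m a j - x j) ^ 2 ∂(poissonPi m x).prod (poissonPi m x) ≤
      C * (2 * ((∑ j, x j) / m)) := by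
    refine mul_le_mul_of_nonneg_left ?_ hC0
    rw [Finset.sum_div, Finset.mul_sum]
    exact Finset.sum_le_sum fun j _ => integral_nodeMin_sub_sq_le hm hx j
  have hm' : (0 : ℝ) < m := by positivity
  have hs : 0 < Real.sqrt m := Real.sqrt_pos.2 hm'
  have hss : Real.sqrt m ^ 2 = m := Real.sq_sqrt hm'.le
  have e : scaledGain F m x - ∑ j, partialDeriv j F x *
      (poissonMeanDiff (m * x j).toNNReal / Real.sqrt (m * x j) * (Real.sqrt (x j) / 2)) =
      -(Real.sqrt m * (∫ a, F (nodeMin m a) ∂(poissonPi m x).prod (poissonPi m x) - F x -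
        ∑ j, (∫ a, (nodeMin m a j - x j) ∂(poissonPi m x).prod (poissonPi m x)) *
          partialDeriv j F x)) := by
    rw [scaledGain, smoothSecond, mul_sub _ _ (∑ j, _), Finset.mul_sum, neg_sub,
      sub_eq_sub_iff_add_eq_add]
    have : ∀ j, Real.sqrt m * ((∫ a, (nodeMin m a j - x j)
        ∂(poissonPi m x).prod (poissonPi m x)) * partialDeriv j F x) =
        - (partialDeriv j F x * (poissonMeanDiff (m * x j).toNNReal / Real.sqrt (m * x j) *
          (Real.sqrt (x j) / 2))) := by
      intro j
      have hx0 : 0 < Real.sqrt (x j) := Real.sqrt_pos.2 (hx j)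
      rw [integral_nodeMin_sub hm hx, Real.sqrt_mul hm'.le]
      field_simp
      rw [hss]
    simp_rw [this, Finset.sum_neg_distrib]
    ring
  rw [e, abs_neg, abs_mul, abs_of_pos hs]
  calc Real.sqrt m * _ ≤ Real.sqrt m * (C * (2 * ((∑ j, x j) / m))) := by
        gcongr
        exact h.trans h2
    _ = _ := by
      field_simp
      rw [hss]
      ring

end Expansions

/-! ### Uniform bounds and pointwise limits in `m` -/

section Limits

variable {d : ℕ} {F : (Fin d → ℝ) → ℝ}

lemma continuousOn_partialDeriv (hF : ContDiffOn ℝ 2 F (posOrthant d)) (j : Fin d) :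
    ContinuousOn (partialDeriv j F) (posOrthant d) :=
  (continuousOn_fderiv hF).clm_apply continuousOn_const

lemma exists_abs_scaledBias_le (hF : ContDiffOn ℝ 2 F (posOrthant d)) (hF1 : ∀ x, |F x| ≤ 1)
    {S : Set (Fin d → ℝ)} (hS : IsCompact S) (hSpos : S ⊆ posOrthant d) :
    ∃ C, ∀ x ∈ S, ∀ m : ℕ, 1 ≤ m → |scaledBias F m x| ≤ C := by
  obtain ⟨C, hC0, hC⟩ := exists_taylor_one_bound hF hF1 hS hSpos
  obtain ⟨R, hR⟩ := hS.exists_bound_of_continuousOn (f := fun x : Fin d → ℝ => ∑ j, x j)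
    (by fun_prop)
  refine ⟨C * R, fun x hx m hm => (abs_scaledBias_le_of hm (hSpos hx) hF1 (hC x hx)).trans ?_⟩
  exact mul_le_mul_of_nonneg_left ((le_abs_self _).trans (hR x hx)) hC0

lemma poissonMeanDiff_nonneg (r : ℝ≥0) : 0 ≤ poissonMeanDiff r :=
  integral_nonneg fun _ => abs_nonneg _

lemma exists_abs_scaledGain_le (hF : ContDiffOn ℝ 2 F (posOrthant d)) (hF1 : ∀ x, |F x| ≤ 1)
    {S : Set (Fin d → ℝ)} (hS : IsCompact S) (hSpos : S ⊆ posOrthant d) :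
    ∃ C, ∀ x ∈ S, ∀ m : ℕ, 1 ≤ m → |scaledGain F m x| ≤ C := by
  obtain ⟨C, hC0, hC⟩ := exists_taylor_one_bound hF hF1 hS hSpos
  obtain ⟨R, hR⟩ := hS.exists_bound_of_continuousOn (f := fun x : Fin d → ℝ => ∑ j, x j)
    (by fun_prop)
  obtain ⟨M, hM⟩ := hS.exists_bound_of_continuousOn
    (f := fun x : Fin d → ℝ => ∑ j, |partialDeriv j F x| * Real.sqrt (x j))
    (continuousOn_finsetSum _ fun j _ =>
      ((continuousOn_partialDeriv hF j).mono hSpos).abs.mul (by fun_prop))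
  refine ⟨2 * C * R + M, fun x hx m hm => ?_⟩
  have h := abs_scaledGain_sub_le hm (hSpos hx) hF1 hC0 (hC x hx)
  have hm' : (1 : ℝ) ≤ m := by exact_mod_cast hm
  have h1 : 2 * C * (∑ j, x j) / Real.sqrt m ≤ 2 * C * R := by
    have h0 : 0 ≤ ∑ j, x j := Finset.sum_nonneg fun j _ => (hSpos hx j).le
    refine (div_le_self (by positivity) (Real.one_le_sqrt.2 hm')).trans ?_
    exact mul_le_mul_of_nonneg_left ((le_abs_self _).trans (hR x hx)) (by positivity)
  have h2 : |∑ j, partialDeriv j F x * (poissonMeanDiff (m * x j).toNNReal /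
      Real.sqrt (m * x j) * (Real.sqrt (x j) / 2))| ≤ M := by
    refine le_trans ?_ ((le_abs_self _).trans (hM x hx))
    refine (Finset.abs_sum_le_sum_abs _ _).trans (Finset.sum_le_sum fun j _ => ?_)
    rw [abs_mul]
    refine mul_le_mul_of_nonneg_left ?_ (abs_nonneg _)
    have hmx : 0 < m * x j := mul_pos (by linarith) (hSpos hx j)
    have h3 := poissonMeanDiff_le (m * x j).toNNReal
    rw [Real.coe_toNNReal _ hmx.le] at h3
    have h4 : poissonMeanDiff (m * x j).toNNReal / Real.sqrt (m * x j) ≤ 2 := by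
      rwa [div_le_iff₀ (Real.sqrt_pos.2 hmx)]
    rw [abs_of_nonneg (mul_nonneg (div_nonneg (poissonMeanDiff_nonneg _) (Real.sqrt_nonneg _))
      (by positivity))]
    nlinarith [Real.sqrt_nonneg (x j)]
  have h5 := abs_sub_abs_le_abs_sub (scaledGain F m x) (∑ j, partialDeriv j F x *
    (poissonMeanDiff (m * x j).toNNReal / Real.sqrt (m * x j) * (Real.sqrt (x j) / 2)))
  linarith

lemma tendsto_scaledGain (hF : ContDiffOn ℝ 2 F (posOrthant d)) (hF1 : ∀ x, |F x| ≤ 1)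
    {x : Fin d → ℝ} (hx : x ∈ posOrthant d) :
    Tendsto (fun m : ℕ => scaledGain F m x) atTop (𝓝 (V F x)) := by
  obtain ⟨C, hC0, hC⟩ := exists_taylor_one_bound hF hF1 isCompact_singleton
    (Set.singleton_subset_iff.2 hx)
  have h1 : Tendsto (fun m : ℕ => ∑ j, partialDeriv j F x *
      (poissonMeanDiff (m * x j).toNNReal / Real.sqrt (m * x j) * (Real.sqrt (x j) / 2)))
      atTop (𝓝 (V F x)) := by
    refine tendsto_finsetSum _ fun j _ => Tendsto.const_mul _ ?_
    have h2 : Tendsto (fun m : ℕ => (m : ℝ) * x j) atTop atTop :=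
      tendsto_natCast_atTop_atTop.atTop_mul_const (hx j)
    have h3 : ∀ m : ℕ, (((m : ℝ) * x j).toNNReal : ℝ) = m * x j := fun m =>
      Real.coe_toNNReal _ (mul_nonneg (Nat.cast_nonneg _) (hx j).le)
    have h4 := tendsto_poissonMeanDiff (r := fun m : ℕ => ((m : ℝ) * x j).toNNReal) (l := atTop)
      (by simpa only [h3] using h2)
    simp only [h3] at h4
    convert h4.mul_const (Real.sqrt (x j) / 2) using 2
    rw [Real.sqrt_div (hx j).le]
    ring
  have h2 : Tendsto (fun m : ℕ => 2 * C * (∑ j, x j) / Real.sqrt m) atTop (𝓝 0) :=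
    tendsto_const_nhds.div_atTop (Real.tendsto_sqrt_atTop.comp tendsto_natCast_atTop_atTop)
  refine (tendsto_iff_of_dist (squeeze_zero' (Eventually.of_forall fun _ => dist_nonneg) ?_ h2)).2
    h1
  filter_upwards [eventually_ge_atTop 1] with m hm
  rw [Real.dist_eq]
  exact abs_scaledGain_sub_le hm hx hF1 hC0 (hC x rfl)

lemma fderiv_fderiv_apply_eq_sum (hF : ContDiffOn ℝ 2 F (posOrthant d)) {x : Fin d → ℝ}
    (hx : x ∈ posOrthant d) (v : Fin d → ℝ) :
    fderiv ℝ (fderiv ℝ F) x v v =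
      ∑ j, ∑ i, v i * v j * partialDeriv i (partialDeriv j F) x := by
  rw [clm_apply_eq_sum]
  refine Finset.sum_congr rfl fun j _ => ?_
  have := clm_apply_eq_sum ((fderiv ℝ (fderiv ℝ F) x).flip (Pi.single j 1)) v
  simp only [ContinuousLinearMap.flip_apply] at this
  rw [this, Finset.mul_sum]
  refine Finset.sum_congr rfl fun i _ => ?_
  rw [partialDeriv_partialDeriv hF hx]
  ring

/-- The linear term is centred, and independence removes the mixed second-order terms; the diagonal
ones have variance `x_j/m` and sum to `B/m`. -/
lemma abs_scaledBias_sub_B_le (hF : ContDiffOn ℝ 2 F (posOrthant d)) (hF1 : ∀ x, |F x| ≤ 1)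
    {x : Fin d → ℝ} (hx : x ∈ posOrthant d) {ε C : ℝ} (hC0 : 0 ≤ C)
    (hC : ∀ y, |F y - F x - fderiv ℝ F x (y - x) -
      (1 / 2) * fderiv ℝ (fderiv ℝ F) x (y - x) (y - x)| ≤
        ε * ∑ j, (y j - x j) ^ 2 + C * ∑ j, (y j - x j) ^ 4) {m : ℕ} (hm : 1 ≤ m) :
    |scaledBias F m x - B F x| ≤ ε * ∑ j, x j + C * (∑ j, (3 * x j ^ 2 + x j)) / m := by
  have hm1 : (1 : ℝ) ≤ m := by exact_mod_cast hm
  have hm' : (0 : ℝ) < m := by linarith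
  have h1 := integrable_node_sub hm hx
  have h2 := fun j => integrable_node_sub_pow hm hx j 2
  have h4 := fun j => integrable_node_sub_pow hm hx j 4
  have hi : Integrable (fun k => F (node m k)) (poissonPi m x) :=
    integrable_of_bounded_discrete fun a => hF1 _
  have hd : Integrable (fun k => F (node m k) - F x) (poissonPi m x) :=
    hi.sub (integrable_const _)
  have hs : Integrable (fun k => ∑ j, (node m k j - x j) * partialDeriv j F x) (poissonPi m x) :=
    integrable_finsetSum _ fun j _ => (h1 j).mul_const _
  have hds : Integrable (fun k => F (node m k) - F x -
      ∑ j, (node m k j - x j) * partialDeriv j F x) (poissonPi m x) := hd.sub hs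
  have hA' : ∀ j, Integrable (fun k => ∑ i, (node m k i - x i) * (node m k j - x j) *
      partialDeriv i (partialDeriv j F) x) (poissonPi m x) := fun j =>
    integrable_finsetSum _ fun i _ => (integrable_node_sub_mul hm hx i j).mul_const _
  have hA : Integrable (fun k => (1 / 2 : ℝ) * ∑ j, ∑ i, (node m k i - x i) * (node m k j - x j) *
      partialDeriv i (partialDeriv j F) x) (poissonPi m x) :=
    (integrable_finsetSum _ fun j _ => hA' j).const_mul _
  have e1 : scaledBias F m x - B F x = m * ∫ k, (F (node m k) - F x -
      fderiv ℝ F x (node m k - x) - (1 / 2) * fderiv ℝ (fderiv ℝ F) x (node m k - x)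
        (node m k - x)) ∂poissonPi m x := by
    simp_rw [fderiv_fderiv_apply_eq_sum hF hx, fderiv_apply_eq_sum, Pi.sub_apply]
    rw [integral_sub hds hA, integral_sub hd hs, integral_sub hi (integrable_const _),
      integral_finsetSum _ fun j _ => (h1 j).mul_const _, integral_const_mul,
      integral_finsetSum _ fun j _ => hA' j]
    have e2 : ∀ j, ∫ k, ∑ i, (node m k i - x i) * (node m k j - x j) *
        partialDeriv i (partialDeriv j F) x ∂poissonPi m x =
        (x j * partialDeriv j (partialDeriv j F) x) / m := by
      intro j
      rw [integral_finsetSum _ fun i _ => (integrable_node_sub_mul hm hx i j).mul_const _]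
      simp_rw [integral_mul_const, integral_node_sub_mul hm hx]
      simp only [ite_mul, zero_mul, Finset.sum_ite_eq', Finset.mem_univ, if_true]
      ring
    simp_rw [e2, integral_mul_const, integral_node_sub hm hx, ← Finset.sum_div]
    simp only [zero_mul, Finset.sum_const_zero, sub_zero, integral_const, probReal_univ, one_smul,
      scaledBias, smoothMean, B]
    field_simp
  have hq2 : Integrable (fun k => ε * ∑ j, (node m k j - x j) ^ 2) (poissonPi m x) :=
    (integrable_finsetSum _ fun j _ => h2 j).const_mul _
  have hq4 : Integrable (fun k => C * ∑ j, (node m k j - x j) ^ 4) (poissonPi m x) :=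
    (integrable_finsetSum _ fun j _ => h4 j).const_mul _
  have e3 : |∫ k, (F (node m k) - F x - fderiv ℝ F x (node m k - x) -
      (1 / 2) * fderiv ℝ (fderiv ℝ F) x (node m k - x) (node m k - x)) ∂poissonPi m x| ≤
      ε * ((∑ j, x j) / m) + C * ∑ j, (3 * x j ^ 2 / m ^ 2 + x j / m ^ 3) := by
    rw [← Real.norm_eq_abs]
    refine (norm_integral_le_of_norm_le (hq2.add hq4)
      (ae_of_all _ fun k => hC (node m k))).trans_eq ?_
    simp only [Pi.add_apply]
    rw [integral_add hq2 hq4, integral_const_mul, integral_const_mul,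
      integral_finsetSum _ fun j _ => h2 j, integral_finsetSum _ fun j _ => h4 j, Finset.sum_div]
    simp_rw [integral_node_sub_sq hm hx, integral_node_sub_pow_four hm hx]
  have e4 : ∑ j, (3 * x j ^ 2 / (m : ℝ) ^ 2 + x j / (m : ℝ) ^ 3) ≤
      (∑ j, (3 * x j ^ 2 + x j)) / (m : ℝ) ^ 2 := by
    rw [Finset.sum_div]
    refine Finset.sum_le_sum fun j _ => ?_
    rw [add_div]
    have := (hx j).le
    gcongr
    norm_num
  rw [e1, abs_mul, abs_of_pos hm']
  calc _ ≤ m * (ε * ((∑ j, x j) / m) + C * ((∑ j, (3 * x j ^ 2 + x j)) / m ^ 2)) := by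
        refine mul_le_mul_of_nonneg_left (e3.trans ?_) hm'.le
        gcongr
    _ = _ := by field_simp

lemma tendsto_scaledBias (hF : ContDiffOn ℝ 2 F (posOrthant d)) (hF1 : ∀ x, |F x| ≤ 1)
    {x : Fin d → ℝ} (hx : x ∈ posOrthant d) :
    Tendsto (fun m : ℕ => scaledBias F m x) atTop (𝓝 (B F x)) := by
  rw [Metric.tendsto_nhds]
  intro ε hε
  have h0 : 0 ≤ ∑ j, x j := Finset.sum_nonneg fun j _ => (hx j).le
  -- Chosen so that `δ ∑ x_j ≤ ε/2`; the `+ 1` covers `d = 0`, where the sum vanishes.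
  set δ := ε / (2 * (∑ j, x j + 1)) with hδ
  have hδ0 : 0 < δ := by positivity
  obtain ⟨C, hC0, hC⟩ := exists_taylor_two_bound hF hF1 hx hδ0
  have h2 : Tendsto (fun m : ℕ => C * (∑ j, (3 * x j ^ 2 + x j)) / (m : ℝ)) atTop (𝓝 0) :=
    tendsto_const_nhds.div_atTop tendsto_natCast_atTop_atTop
  filter_upwards [eventually_ge_atTop 1, h2.eventually_lt_const (half_pos hε)] with m hm h3
  have h4 := abs_scaledBias_sub_B_le hF hF1 hx hC0 hC hm
  have h5 : δ * ∑ j, x j ≤ ε / 2 := by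
    rw [hδ, div_mul_eq_mul_div, div_le_div_iff₀ (by positivity) (by norm_num)]
    nlinarith
  rw [Real.dist_eq]
  linarith

end Limits

/-! ### Measurability in `x` of the Poisson averages -/

section Measurability

variable {d : ℕ} {F : (Fin d → ℝ) → ℝ} {S : Set (Fin d → ℝ)}

lemma measurable_poissonWeight (m k : Fin d → ℕ) : Measurable (poissonWeight m k) := by
  unfold poissonWeight
  fun_prop

/-- Here the measure itself depends on `x`. The integral is a pointwise limit of finite sums with
continuous weights. Letting `f` depend on `x` too makes the lemma iterable for the double average in
`smoothSecond`. -/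
lemma aestronglyMeasurable_poissonPi_integral (m : ℕ) (hS : MeasurableSet S)
    (hSpos : S ⊆ posOrthant d) {f : (Fin d → ℕ) → (Fin d → ℝ) → ℝ} {C : ℝ}
    (hf : ∀ k x, |f k x| ≤ C) (hfm : ∀ k, AEStronglyMeasurable (f k) (volume.restrict S)) :
    AEStronglyMeasurable (fun x => ∫ k, f k x ∂poissonPi m x) (volume.restrict S) := by
  refine aestronglyMeasurable_of_tendsto_ae
    (u := (atTop : Filter (Finset (Fin d → ℕ))))
    (f := fun s x => ∑ k ∈ s, f k x * poissonWeight (fun _ => m) k x) (fun s => ?_) ?_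
  · exact Finset.aestronglyMeasurable_fun_sum _ fun k _ =>
      (hfm k).mul (measurable_poissonWeight _ k).aestronglyMeasurable
  · filter_upwards [ae_restrict_mem hS] with x hx
    exact hasSum_poissonPi m (hSpos hx) fun k => hf k x

lemma aestronglyMeasurable_smoothMean (hF1 : ∀ x, |F x| ≤ 1) (m : ℕ) (hS : MeasurableSet S)
    (hSpos : S ⊆ posOrthant d) :
    AEStronglyMeasurable (smoothMean F m) (volume.restrict S) :=
  aestronglyMeasurable_poissonPi_integral m hS hSpos (f := fun k _ => F (node m k))
    (fun _ _ => hF1 _) fun _ => aestronglyMeasurable_const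

lemma abs_integral_le_one {α : Type*} [MeasurableSpace α] {ρ : Measure α} [IsProbabilityMeasure ρ]
    {f : α → ℝ} (hf : ∀ a, |f a| ≤ 1) : |∫ a, f a ∂ρ| ≤ 1 := by
  simpa using norm_integral_le_of_norm_le_const (μ := ρ) (f := f) (C := 1) (ae_of_all _ hf)

lemma aestronglyMeasurable_smoothSecond (hF1 : ∀ x, |F x| ≤ 1) (m : ℕ) (hS : MeasurableSet S)
    (hSpos : S ⊆ posOrthant d) :
    AEStronglyMeasurable (smoothSecond F m) (volume.restrict S) := by
  have h : smoothSecond F m = fun x => ∫ k, ∫ l, F (nodeMin m (k, l)) ∂poissonPi m x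
      ∂poissonPi m x := by
    ext x
    exact integral_prod _ (integrable_of_bounded_discrete fun _ => hF1 _)
  rw [h]
  exact aestronglyMeasurable_poissonPi_integral m hS hSpos
    (f := fun k x => ∫ l, F (nodeMin m (k, l)) ∂poissonPi m x)
    (fun k x => abs_integral_le_one fun _ => hF1 _) fun k =>
      aestronglyMeasurable_poissonPi_integral m hS hSpos (f := fun l _ => F (nodeMin m (k, l)))
        (fun _ _ => hF1 _) fun _ => aestronglyMeasurable_const

end Measurability

/-! ### The estimator as a sample mean -/

section Kernel

variable {d : ℕ}

lemma measurable_indicator_Iic (x : Fin d → ℝ) :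
    Measurable (Set.indicator (Set.Iic x) (fun _ => (1 : ℝ))) :=
  measurable_const.indicator measurableSet_Iic

lemma abs_indicator_one_le {α : Type*} (s : Set α) (y : α) :
    |Set.indicator s (fun _ => (1 : ℝ)) y| ≤ 1 := by
  by_cases h : y ∈ s <;> simp [h]

lemma integral_indicator_Iic (μ : Measure (Fin d → ℝ)) (x : Fin d → ℝ) :
    ∫ y, Set.indicator (Set.Iic x) (fun _ => (1 : ℝ)) y ∂μ = distFun μ x := by
  rw [integral_indicator_const _ measurableSet_Iic, distFun, smul_eq_mul, mul_one]

/-- The contribution of an observation at `y` to the Szász–Mirakyan estimator. -/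
noncomputable def smoothKernel (m : ℕ) (x y : Fin d → ℝ) : ℝ :=
  ∫ k, Set.indicator (Set.Iic (node m k)) (fun _ => (1 : ℝ)) y ∂poissonPi m x

/-- The Poisson series is exchanged with the finite sum over observations, reducing the error to
that of an i.i.d. average. -/
lemma estimator_eq {Ω : Type*} {X : ℕ → Ω → Fin d → ℝ} (m n : ℕ) {x : Fin d → ℝ} (hx : x ∈ posOrthant d) (ω : Ω) :
    estimator X (fun _ => m) n x ω =
      (n : ℝ)⁻¹ * ∑ i ∈ Finset.range n, smoothKernel m x (X i ω) := by
  have h := (hasSum_sum (s := Finset.range n) fun i _ => hasSum_poissonPi m hx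
    (f := fun k => Set.indicator (Set.Iic (node m k)) (fun _ => (1 : ℝ)) (X i ω)) (C := 1)
    fun k => abs_indicator_one_le _ _).mul_left (n : ℝ)⁻¹
  unfold smoothKernel
  rw [← h.tsum_eq, estimator]
  refine tsum_congr fun k => ?_
  rw [empiricalCdf, mul_assoc, Finset.sum_mul]
  rfl

lemma measurable_uncurry_indicator_Iic {α : Type*} [MeasurableSpace α] {Y : α → Fin d → ℝ}
    (hY : Measurable Y) : Measurable (Function.uncurry fun (y : Fin d → ℝ) (a : α) =>
      Set.indicator (Set.Iic (Y a)) (fun _ => (1 : ℝ)) y) := by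
  have h : (Function.uncurry fun (y : Fin d → ℝ) (a : α) =>
      Set.indicator (Set.Iic (Y a)) (fun _ => (1 : ℝ)) y) =
      Set.indicator {p : (Fin d → ℝ) × α | p.1 ≤ Y p.2} fun _ => (1 : ℝ) := by
    classical
    ext ⟨y, a⟩
    simp only [Function.uncurry, Set.indicator_apply, Set.mem_Iic, Set.mem_ofPred_eq]
  rw [h]
  exact measurable_const.indicator
    (measurableSet_le measurable_fst (hY.comp measurable_snd))

end Kernel

/-! ### Exact mean squared errors -/

section Mse

variable {d : ℕ} {Ω : Type*} [MeasurableSpace Ω] {P : Measure Ω} [IsProbabilityMeasure P]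
  {μ : Measure (Fin d → ℝ)} {X : ℕ → Ω → Fin d → ℝ}

lemma mse_eq_variance_add {T : Ω → ℝ} (hT : MemLp T 2 P) (θ : ℝ) :
    mse P T θ = variance T P + (∫ ω, T ω ∂P - θ) ^ 2 := by
  have h1 : Integrable T P := hT.integrable (by norm_num)
  have h2 : Integrable (fun ω => T ω ^ 2) P := hT.integrable_sq
  rw [variance_eq_sub hT, mse]
  have h : ∀ ω, (T ω - θ) ^ 2 = T ω ^ 2 - 2 * θ * T ω + θ ^ 2 := fun ω => by ring
  have h3 : Integrable (fun ω => T ω ^ 2 - 2 * θ * T ω) P := h2.sub (h1.const_mul _)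
  simp_rw [h]
  rw [integral_add h3 (integrable_const _), integral_sub h2 (h1.const_mul _), integral_const_mul]
  simp
  ring

lemma mse_sampleMean (hlaw : ∀ i, HasLaw (X i) μ P) (hindep : iIndepFun X P)
    {h : (Fin d → ℝ) → ℝ} (hm : Measurable h) (h1 : ∀ y, |h y| ≤ 1) {n : ℕ} (hn : 1 ≤ n) (θ : ℝ) :
    mse P (fun ω => (n : ℝ)⁻¹ * ∑ i ∈ Finset.range n, h (X i ω)) θ =
      (n : ℝ)⁻¹ * (∫ y, h y ^ 2 ∂μ - (∫ y, h y ∂μ) ^ 2) + (∫ y, h y ∂μ - θ) ^ 2 := by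
  have hn' : (n : ℝ) ≠ 0 := by positivity
  have hX : ∀ i, AEMeasurable (fun ω => h (X i ω)) P := fun i =>
    hm.comp_aemeasurable (hlaw i).aemeasurable
  have hL : ∀ i, MemLp (fun ω => h (X i ω)) 2 P := fun i =>
    MemLp.of_bound (hX i).aestronglyMeasurable 1 (ae_of_all _ fun ω => h1 _)
  have hE : ∀ i, ∫ ω, h (X i ω) ∂P = ∫ y, h y ∂μ := fun i =>
    (hlaw i).integral_comp hm.aestronglyMeasurable
  have hE2 : ∀ i, ∫ ω, h (X i ω) ^ 2 ∂P = ∫ y, h y ^ 2 ∂μ := fun i =>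
    (hlaw i).integral_comp (f := fun y => h y ^ 2) (hm.pow_const 2).aestronglyMeasurable
  have hS : MemLp (fun ω => ∑ i ∈ Finset.range n, h (X i ω)) 2 P :=
    memLp_finsetSum _ fun i _ => hL i
  have hvar : variance (fun ω => ∑ i ∈ Finset.range n, h (X i ω)) P =
      n * (∫ y, h y ^ 2 ∂μ - (∫ y, h y ∂μ) ^ 2) := by
    have h2 := IndepFun.variance_sum (X := fun i ω => h (X i ω)) (s := Finset.range n) (μ := P)
      (fun i _ => hL i) fun i _ j _ hij => (hindep.indepFun hij).comp hm hm
    have h3 : (∑ i ∈ Finset.range n, fun ω => h (X i ω)) =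
        fun ω => ∑ i ∈ Finset.range n, h (X i ω) := by
      ext ω
      simp
    rw [h3] at h2
    rw [h2]
    have h4 : ∀ i, variance (fun ω => h (X i ω)) P = ∫ y, h y ^ 2 ∂μ - (∫ y, h y ∂μ) ^ 2 := by
      intro i
      rw [variance_eq_sub (hL i), hE i, ← hE2 i]
      rfl
    simp only [h4, Finset.sum_const, Finset.card_range, nsmul_eq_mul]
  rw [mse_eq_variance_add (hS.const_mul _), variance_const_mul, hvar, integral_const_mul,
    integral_finsetSum _ fun i _ => (hL i).integrable (by norm_num)]
  simp only [hE, Finset.sum_const, Finset.card_range, nsmul_eq_mul]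
  field_simp

lemma mse_empiricalCdf (hlaw : ∀ i, HasLaw (X i) μ P) (hindep : iIndepFun X P) {n : ℕ}
    (hn : 1 ≤ n) (x : Fin d → ℝ) :
    mse P (empiricalCdf X n x) (distFun μ x) = sigmaSq (distFun μ) x / n := by
  have h := mse_sampleMean hlaw hindep (measurable_indicator_Iic x)
    (abs_indicator_one_le (Set.Iic x)) hn (distFun μ x)
  have h2 : ∀ y, Set.indicator (Set.Iic x) (fun _ => (1 : ℝ)) y ^ 2 =
      Set.indicator (Set.Iic x) (fun _ => (1 : ℝ)) y := fun y => by
    by_cases h : y ∈ Set.Iic x <;> simp [h]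
  simp_rw [h2, integral_indicator_Iic] at h
  refine h.trans ?_
  rw [sigmaSq]
  ring

lemma integral_integral_indicator_Iic [IsProbabilityMeasure μ] {α : Type*} [MeasurableSpace α] {ρ : Measure α}
    [IsProbabilityMeasure ρ] {Y : α → Fin d → ℝ} (hY : Measurable Y) :
    ∫ y, ∫ a, Set.indicator (Set.Iic (Y a)) (fun _ => (1 : ℝ)) y ∂ρ ∂μ =
      ∫ a, distFun μ (Y a) ∂ρ := by
  rw [integral_integral_swap]
  · simp_rw [integral_indicator_Iic]
  · exact Integrable.of_bound (measurable_uncurry_indicator_Iic hY).aestronglyMeasurable 1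
      (ae_of_all _ fun p => abs_indicator_one_le _ _)

lemma measurable_smoothKernel (m : ℕ) (x : Fin d → ℝ) : Measurable (smoothKernel m x) :=
  ((measurable_uncurry_indicator_Iic (Y := node m)
    Measurable.of_discrete).stronglyMeasurable.integral_prod_right).measurable

/-- A squared probability is the probability that two independent copies both satisfy `y ≤ N/m`,
that is, `y ≤ min(N, N')/m`. -/
lemma smoothKernel_sq (m : ℕ) (x y : Fin d → ℝ) :
    smoothKernel m x y ^ 2 = ∫ p, Set.indicator (Set.Iic (nodeMin m p)) (fun _ => (1 : ℝ)) y
      ∂(poissonPi m x).prod (poissonPi m x) := by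
  rw [pow_two, smoothKernel, ← integral_prod_mul]
  refine integral_congr_ae (ae_of_all _ fun p => ?_)
  classical
  simp only [nodeMin, ← Set.Iic_inter_Iic, Set.indicator_apply, Set.mem_inter_iff]
  by_cases h1 : y ∈ Set.Iic (node m p.1) <;> by_cases h2 : y ∈ Set.Iic (node m p.2) <;>
    simp [h1, h2]

lemma mse_estimator [IsProbabilityMeasure μ] (hlaw : ∀ i, HasLaw (X i) μ P) (hindep : iIndepFun X P) {n : ℕ}
    (hn : 1 ≤ n) (m : ℕ) {x : Fin d → ℝ} (hx : x ∈ posOrthant d) :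
    mse P (estimator X (fun _ => m) n x) (distFun μ x) =
      (n : ℝ)⁻¹ * (smoothSecond (distFun μ) m x - smoothMean (distFun μ) m x ^ 2) +
        (smoothMean (distFun μ) m x - distFun μ x) ^ 2 := by
  have h := mse_sampleMean hlaw hindep (measurable_smoothKernel m x)
    (fun y => abs_integral_le_one fun k => abs_indicator_one_le _ _) hn (distFun μ x)
  have h0 : estimator X (fun _ => m) n x = fun ω =>
    (n : ℝ)⁻¹ * ∑ i ∈ Finset.range n, smoothKernel m x (X i ω) := funext (estimator_eq m n hx)
  rw [h0, h]
  simp_rw [smoothKernel_sq, smoothKernel]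
  rw [integral_integral_indicator_Iic Measurable.of_discrete,
    integral_integral_indicator_Iic Measurable.of_discrete]
  rfl

/-- The coefficient of `-m^{-1/2} n^{-1}` in the mean squared error. -/
noncomputable def varianceGain (F : (Fin d → ℝ) → ℝ) (m : ℕ) (x : Fin d → ℝ) : ℝ :=
  scaledGain F m x + 2 * F x * scaledBias F m x / Real.sqrt m +
    scaledBias F m x ^ 2 / (m * Real.sqrt m)

/-- An identity without remainder: the difference between `F²` and the squared mean is kept inside
`varianceGain`. It can therefore be integrated over `S` unchanged. -/
lemma mul_mse_estimator [IsProbabilityMeasure μ] (hlaw : ∀ i, HasLaw (X i) μ P) (hindep : iIndepFun X P) {n m : ℕ}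
    (hn : 1 ≤ n) (hm : 1 ≤ m) {x : Fin d → ℝ} (hx : x ∈ posOrthant d) :
    n * mse P (estimator X (fun _ => m) n x) (distFun μ x) =
      sigmaSq (distFun μ) x - varianceGain (distFun μ) m x / Real.sqrt m +
        n * scaledBias (distFun μ) m x ^ 2 / (m : ℝ) ^ 2 := by
  have hn' : (n : ℝ) ≠ 0 := by positivity
  have hm' : (0 : ℝ) < m := by positivity
  have hs : 0 < Real.sqrt m := Real.sqrt_pos.2 hm'
  have hss : Real.sqrt m ^ 2 = m := Real.sq_sqrt hm'.le
  rw [mse_estimator hlaw hindep hn m hx, varianceGain, scaledGain, scaledBias, sigmaSq]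
  generalize smoothSecond (distFun μ) m x = a
  generalize smoothMean (distFun μ) m x = b
  generalize distFun μ x = c
  generalize Real.sqrt m = t at *
  rw [← hss]
  field_simp
  ring

end Mse

/-! ### From error expansions to deficiency expansions -/

section Deficiency

lemma sInf_deficiency_bounds {s A : ℝ} (hs : 0 < s) (hA : 0 < A) :
    s / A ≤ (sInf {k : ℕ | 1 ≤ k ∧ s / k ≤ A} : ℕ) ∧
      ((sInf {k : ℕ | 1 ≤ k ∧ s / k ≤ A} : ℕ) : ℝ) ≤ s / A + 1 := by
  have hsA : 0 < s / A := div_pos hs hA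
  have hmem : ⌈s / A⌉₊ ∈ {k : ℕ | 1 ≤ k ∧ s / k ≤ A} := by
    have h1 : 0 < ⌈s / A⌉₊ := Nat.ceil_pos.2 hsA
    refine ⟨h1, ?_⟩
    rw [div_le_comm₀ (by exact_mod_cast h1) hA]
    exact Nat.le_ceil _
  constructor
  · obtain ⟨h1, h2⟩ := Nat.sInf_mem ⟨_, hmem⟩
    rwa [div_le_comm₀ (by exact_mod_cast h1) hA] at h2
  · exact (Nat.cast_le.2 (Nat.sInf_le hmem)).trans (Nat.ceil_lt_add_one hsA.le).le

/-- Since `s/A - n = n(s - nA)/(nA)` and `D` differs from `s/A` by at most 1, the rounding error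
disappears for any scale `r → ∞`. -/
lemma tendsto_deficiency_sub_div {D : ℕ → ℕ} {A r : ℕ → ℝ} {s w : ℝ} (hs : 0 < s)
    (hD : ∀ n, D n = sInf {k : ℕ | 1 ≤ k ∧ s / k ≤ A n})
    (hA : Tendsto (fun n : ℕ => n * A n) atTop (𝓝 s)) (hr : Tendsto r atTop atTop)
    (hw : Tendsto (fun n : ℕ => (n / r n) * (s - n * A n)) atTop (𝓝 w)) :
    Tendsto (fun n : ℕ => ((D n : ℝ) - n) / r n) atTop (𝓝 (w / s)) ∧
      (0 < w / s → Tendsto (fun n : ℕ => (D n : ℝ) - n) atTop atTop) := by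
  have h1 : Tendsto (fun n : ℕ => (n / r n) * (s - n * A n) / (n * A n)) atTop (𝓝 (w / s)) :=
    hw.div hA hs.ne'
  have h2 : Tendsto (fun n : ℕ => (n / r n) * (s - n * A n) / (n * A n) + (r n)⁻¹) atTop
      (𝓝 (w / s)) := by
    simpa using h1.add hr.inv_tendsto_atTop
  have hbd : ∀ᶠ n : ℕ in atTop, (n / r n) * (s - n * A n) / (n * A n) ≤ ((D n : ℝ) - n) / r n ∧
      ((D n : ℝ) - n) / r n ≤ (n / r n) * (s - n * A n) / (n * A n) + (r n)⁻¹ := by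
    filter_upwards [hA.eventually_const_lt hs, hr.eventually_gt_atTop 0, eventually_ge_atTop 1]
      with n hn hrn hn1
    have hn' : (0 : ℝ) < n := by exact_mod_cast hn1
    have hAn : 0 < A n := pos_of_mul_pos_right hn hn'.le
    obtain ⟨h3, h4⟩ := sInf_deficiency_bounds hs hAn
    rw [← hD n] at h3 h4
    have e : (n / r n) * (s - n * A n) / (n * A n) = (s / A n - n) / r n := by
      field_simp
    rw [e, ← one_div, ← add_div]
    constructor
    · gcongr
    · gcongr
      linarith
  have h3 := tendsto_of_tendsto_of_tendsto_of_le_of_le' h1 h2 (hbd.mono fun n h => h.1)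
    (hbd.mono fun n h => h.2)
  refine ⟨h3, fun hpos => ?_⟩
  refine (h3.pos_mul_atTop hpos hr).congr' ?_
  filter_upwards [hr.eventually_gt_atTop 0] with n hn
  field_simp

variable {m : ℕ → ℕ} {A v' b' : ℕ → ℝ} {s v b : ℝ}

lemma tendsto_atTop_of_div_sq (hm : ∀ n, 1 ≤ m n)
    (h : Tendsto (fun n : ℕ => (n : ℝ) / (m n : ℝ) ^ 2) atTop (𝓝 0)) :
    Tendsto m atTop atTop := by
  refine tendsto_atTop.2 fun K => ?_
  filter_upwards [h.eventually_lt_const one_pos, eventually_ge_atTop (K ^ 2)] with n h1 hn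
  have hmn : (0 : ℝ) < (m n : ℝ) ^ 2 := pow_pos (by exact_mod_cast hm n) 2
  rw [div_lt_one hmn] at h1
  have h2 : n < m n ^ 2 := by exact_mod_cast h1
  exact (lt_of_pow_lt_pow_left₀ 2 (Nat.zero_le _) (hn.trans_lt h2)).le

lemma tendsto_mul_error (hm : ∀ n, 1 ≤ m n) (hv : Tendsto v' atTop (𝓝 v))
    (hb : Tendsto b' atTop (𝓝 b))
    (hA : ∀ n : ℕ, 1 ≤ n →
      n * A n = s - v' (m n) / Real.sqrt (m n) + n * b' (m n) / (m n : ℝ) ^ 2)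
    (h : Tendsto (fun n : ℕ => (n : ℝ) / (m n : ℝ) ^ 2) atTop (𝓝 0)) :
    Tendsto (fun n : ℕ => n * A n) atTop (𝓝 s) := by
  have hmt := tendsto_atTop_of_div_sq hm h
  have h1 : Tendsto (fun n => v' (m n) / Real.sqrt (m n)) atTop (𝓝 0) :=
    (hv.comp hmt).div_atTop
      (Real.tendsto_sqrt_atTop.comp (tendsto_natCast_atTop_atTop.comp hmt))
  have h2 := h.mul (hb.comp hmt)
  have h3 := (h1.const_sub s).add h2
  rw [sub_zero, zero_mul, add_zero] at h3
  refine h3.congr' ?_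
  filter_upwards [eventually_ge_atTop 1] with n hn
  rw [hA n hn, Function.comp]
  ring

theorem deficiencyExpansions_of_error {D : ℕ → ℕ} (hs : 0 < s) (hm : ∀ n, 1 ≤ m n)
    (hD : ∀ n, D n = sInf {k : ℕ | 1 ≤ k ∧ s / k ≤ A n})
    (hv : Tendsto v' atTop (𝓝 v)) (hb : Tendsto b' atTop (𝓝 b))
    (hA : ∀ n : ℕ, 1 ≤ n →
      n * A n = s - v' (m n) / Real.sqrt (m n) + n * b' (m n) / (m n : ℝ) ^ 2) :
    DeficiencyExpansions D m s v b := by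
  have hm0 : ∀ n, (0 : ℝ) < m n := fun n => by exact_mod_cast hm n
  refine ⟨fun h => ?_, fun h1 h2 => ?_, fun c hc h1 => ?_⟩
  · have hAs := tendsto_mul_error hm hv hb hA h
    -- At scale `r = n` the required limit is that of `s - nA`, namely 0.
    have h2 := (tendsto_deficiency_sub_div (r := fun n : ℕ => (n : ℝ)) (w := 0) hs hD hAs
      tendsto_natCast_atTop_atTop ?_).1
    · have h3 := h2.add_const 1
      rw [zero_div, zero_add] at h3
      refine h3.congr' ?_
      filter_upwards [eventually_ge_atTop 1] with n hn
      field_simp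
      ring
    · have h3 := hAs.const_sub s
      rw [sub_self] at h3
      refine h3.congr' ?_
      filter_upwards [eventually_ge_atTop 1] with n hn
      field_simp
  -- `n/m^{3/2}` is the size of the squared bias relative to the variance gain; it is the power
  -- `-3/2` of `m n^{-2/3}`.
  · have h3 : Tendsto (fun n : ℕ => (n : ℝ) / (m n * Real.sqrt (m n))) atTop (𝓝 0) := by
      refine ((tendsto_rpow_neg_atTop (y := 3 / 2) (by norm_num)).comp h1).congr' ?_
      filter_upwards [eventually_ge_atTop 1] with n hn
      have hn' : (0 : ℝ) < n := by exact_mod_cast hn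
      have e : (m n : ℝ) * Real.sqrt (m n) = (m n : ℝ) ^ (3 / 2 : ℝ) := by
        rw [Real.sqrt_eq_rpow, ← Real.rpow_one_add' (hm0 n).le (by norm_num)]
        norm_num
      rw [Function.comp, Real.mul_rpow (hm0 n).le (by positivity), ← Real.rpow_mul hn'.le, e,
        Real.rpow_neg (hm0 n).le]
      norm_num
      field_simp
    have h4 : Tendsto (fun n : ℕ => (n : ℝ) / (m n : ℝ) ^ 2) atTop (𝓝 0) := by
      refine squeeze_zero (fun n => by positivity) (fun n => ?_) h3
      have := hm0 n
      rw [pow_two]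
      gcongr
      rw [Real.sqrt_le_left this.le]
      have : (1 : ℝ) ≤ m n := by exact_mod_cast hm n
      nlinarith
    have hmt := tendsto_atTop_of_div_sq hm h4
    -- The condition `m n⁻² → 0` says exactly that the scale `n/√m` tends to infinity and so
    -- dominates the rounding.
    have hr : Tendsto (fun n : ℕ => (n : ℝ) / Real.sqrt (m n)) atTop atTop := by
      have h5 : Tendsto (fun n : ℕ => Real.sqrt ((m n : ℝ) / (n : ℝ) ^ 2)) atTop (𝓝[>] 0) := by
        refine tendsto_nhdsWithin_iff.2 ⟨by simpa using h2.sqrt, ?_⟩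
        filter_upwards [eventually_ge_atTop 1] with n hn
        have hn' : (0 : ℝ) < n := by exact_mod_cast hn
        have := hm0 n
        exact Real.sqrt_pos.2 (by positivity)
      refine h5.inv_tendsto_nhdsGT_zero.congr fun n => ?_
      rw [Pi.inv_apply, Real.sqrt_div (hm0 n).le, Real.sqrt_sq (Nat.cast_nonneg _), inv_div]
    have key := tendsto_deficiency_sub_div (w := v) hs hD (tendsto_mul_error hm hv hb hA h4) hr ?_
    · refine ⟨key.1, fun hv0 => key.2 (div_pos hv0 hs)⟩
    · have h5 := (hv.comp hmt).sub (h3.mul (hb.comp hmt))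
      rw [zero_mul, sub_zero] at h5
      refine h5.congr' ?_
      filter_upwards [eventually_ge_atTop 1] with n hn
      have hn' : (0 : ℝ) < n := by exact_mod_cast hn
      have := hm0 n
      have hsq : Real.sqrt (m n) ^ 2 = m n := Real.sq_sqrt this.le
      have hsp : 0 < Real.sqrt (m n) := Real.sqrt_pos.2 this
      simp only [Function.comp]
      rw [hA n hn]
      generalize v' (m n) = α
      generalize b' (m n) = β
      generalize Real.sqrt (m n) = t at *
      rw [← hsq]
      field_simp
      ring
  · have hr : Tendsto (fun n : ℕ => (n : ℝ) ^ (2 / 3 : ℝ)) atTop atTop :=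
      (tendsto_rpow_atTop (by norm_num)).comp tendsto_natCast_atTop_atTop
    -- At scale `n^{2/3}` the gain and the squared bias carry the factors `n^{1/3}/√m` and
    -- `n^{4/3}/m²`, the powers `-1/2` and `-2` of `m n^{-2/3}`. Both have finite nonzero limits, so
    -- the two effects balance.
    have h2 := h1.rpow_const (p := (-(1 / 2) : ℝ)) (Or.inl hc.ne')
    have h3 := h1.rpow_const (p := (-2 : ℝ)) (Or.inl hc.ne')
    have e2 : ∀ n : ℕ, 1 ≤ n → ((m n : ℝ) * (n : ℝ) ^ (-(2 / 3) : ℝ)) ^ (-(1 / 2) : ℝ) =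
        (n : ℝ) ^ (1 / 3 : ℝ) / Real.sqrt (m n) := by
      intro n hn
      have hn' : (0 : ℝ) < n := by exact_mod_cast hn
      rw [Real.mul_rpow (hm0 n).le (by positivity), ← Real.rpow_mul hn'.le,
        Real.rpow_neg (hm0 n).le, ← Real.sqrt_eq_rpow]
      norm_num
      field_simp
    have e3 : ∀ n : ℕ, 1 ≤ n → ((m n : ℝ) * (n : ℝ) ^ (-(2 / 3) : ℝ)) ^ (-2 : ℝ) =
        (n : ℝ) ^ (4 / 3 : ℝ) / (m n : ℝ) ^ 2 := by
      intro n hn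
      have hn' : (0 : ℝ) < n := by exact_mod_cast hn
      rw [Real.mul_rpow (hm0 n).le (by positivity), ← Real.rpow_mul hn'.le,
        Real.rpow_neg (hm0 n).le, Real.rpow_two]
      norm_num
      field_simp
    have h4 : Tendsto (fun n : ℕ => (n : ℝ) / (m n : ℝ) ^ 2) atTop (𝓝 0) := by
      have h5 := h3.mul ((tendsto_rpow_neg_atTop (y := 1 / 3) (by norm_num)).comp
        tendsto_natCast_atTop_atTop)
      rw [mul_zero] at h5
      refine h5.congr' ?_
      filter_upwards [eventually_ge_atTop 1] with n hn
      have hn' : (0 : ℝ) < n := by exact_mod_cast hn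
      rw [e3 n hn, Function.comp, div_mul_eq_mul_div, ← Real.rpow_add hn']
      norm_num
    have hmt := tendsto_atTop_of_div_sq hm h4
    have key := tendsto_deficiency_sub_div (w := c ^ (-(1 / 2) : ℝ) * v - c ^ (-2 : ℝ) * b) hs hD
      (tendsto_mul_error hm hv hb hA h4) hr ?_
    · have e : (c ^ (-(1 / 2) : ℝ) * v - c ^ (-2 : ℝ) * b) / s =
        c ^ (-(1 / 2) : ℝ) * (v / s) - c ^ (-2 : ℝ) * (b / s) := by ring
      rwa [e] at key
    · refine ((h2.mul (hv.comp hmt)).sub (h3.mul (hb.comp hmt))).congr' ?_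
      filter_upwards [eventually_ge_atTop 1] with n hn
      have hn' : (0 : ℝ) < n := by exact_mod_cast hn
      have e4 : (n : ℝ) / (n : ℝ) ^ (2 / 3 : ℝ) = (n : ℝ) ^ (1 / 3 : ℝ) := by
        nth_rewrite 1 [← Real.rpow_one (n : ℝ)]
        rw [← Real.rpow_sub hn']
        norm_num
      have e5 : (n : ℝ) ^ (4 / 3 : ℝ) = (n : ℝ) ^ (1 / 3 : ℝ) * n := by
        rw [← Real.rpow_add_one hn'.ne']
        norm_num
      rw [e2 n hn, e3 n hn, e4, e5, hA n hn, Function.comp, Function.comp]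
      ring

end Deficiency

/-! ### Local and global deficiencies -/

section LocalGlobal

variable {d : ℕ} {F : (Fin d → ℝ) → ℝ} {S : Set (Fin d → ℝ)}

lemma tendsto_varianceGain (hF : ContDiffOn ℝ 2 F (posOrthant d)) (hF1 : ∀ x, |F x| ≤ 1)
    {x : Fin d → ℝ} (hx : x ∈ posOrthant d) :
    Tendsto (fun m : ℕ => varianceGain F m x) atTop (𝓝 (V F x)) := by
  have hb := tendsto_scaledBias hF hF1 hx
  have hm : Tendsto (fun m : ℕ => (m : ℝ)) atTop atTop := tendsto_natCast_atTop_atTop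
  have hs : Tendsto (fun m : ℕ => Real.sqrt m) atTop atTop := Real.tendsto_sqrt_atTop.comp hm
  have h := ((tendsto_scaledGain hF hF1 hx).add
    ((hb.const_mul (2 * F x)).div_atTop hs)).add ((hb.pow 2).div_atTop (hm.atTop_mul_atTop₀ hs))
  simp only [add_zero] at h
  exact h

lemma exists_abs_varianceGain_le (hF : ContDiffOn ℝ 2 F (posOrthant d)) (hF1 : ∀ x, |F x| ≤ 1)
    (hS : IsCompact S) (hSpos : S ⊆ posOrthant d) :
    ∃ C, ∀ x ∈ S, ∀ m : ℕ, 1 ≤ m → |varianceGain F m x| ≤ C := by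
  obtain ⟨C₁, h1⟩ := exists_abs_scaledGain_le hF hF1 hS hSpos
  obtain ⟨C₂, h2⟩ := exists_abs_scaledBias_le hF hF1 hS hSpos
  refine ⟨C₁ + 2 * C₂ + C₂ ^ 2, fun x hx m hm => ?_⟩
  have hm1 : (1 : ℝ) ≤ m := by exact_mod_cast hm
  have hs1 : 1 ≤ Real.sqrt m := Real.one_le_sqrt.2 hm1
  have hb := h2 x hx m hm
  have hb0 := abs_nonneg (scaledBias F m x)
  refine (abs_add_three _ _ _).trans (add_le_add (add_le_add (h1 x hx m hm) ?_) ?_)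
  · rw [abs_div, abs_mul, abs_mul, abs_two, abs_of_nonneg (Real.sqrt_nonneg _)]
    refine (div_le_self (by positivity) hs1).trans ?_
    nlinarith [hF1 x, abs_nonneg (F x)]
  · rw [abs_div, abs_of_nonneg (by positivity : 0 ≤ (m : ℝ) * Real.sqrt m), abs_pow]
    refine (div_le_self (by positivity) (by nlinarith)).trans ?_
    gcongr

lemma aestronglyMeasurable_scaledBias (hF : ContDiffOn ℝ 2 F (posOrthant d))
    (hF1 : ∀ x, |F x| ≤ 1) (m : ℕ) (hS : MeasurableSet S) (hSpos : S ⊆ posOrthant d) :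
    AEStronglyMeasurable (scaledBias F m) (volume.restrict S) :=
  ((aestronglyMeasurable_smoothMean hF1 m hS hSpos).sub
    ((hF.continuousOn.mono hSpos).aestronglyMeasurable hS)).const_mul _

lemma aestronglyMeasurable_varianceGain (hF : ContDiffOn ℝ 2 F (posOrthant d))
    (hF1 : ∀ x, |F x| ≤ 1) (m : ℕ) (hS : MeasurableSet S) (hSpos : S ⊆ posOrthant d) :
    AEStronglyMeasurable (varianceGain F m) (volume.restrict S) := by
  have hFm := (hF.continuousOn.mono hSpos).aestronglyMeasurable (μ := volume) hS
  have hb := aestronglyMeasurable_scaledBias hF hF1 m hS hSpos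
  have hg : AEStronglyMeasurable (scaledGain F m) (volume.restrict S) :=
    (hFm.sub (aestronglyMeasurable_smoothSecond hF1 m hS hSpos)).const_mul _
  have h1 : AEStronglyMeasurable (fun x => 2 * F x * scaledBias F m x / Real.sqrt m)
      (volume.restrict S) := by
    simp_rw [div_eq_mul_inv]
    exact ((hFm.const_mul 2).mul hb).mul_const _
  have h2 : AEStronglyMeasurable (fun x => scaledBias F m x ^ 2 / (m * Real.sqrt m))
      (volume.restrict S) := by
    simp_rw [div_eq_mul_inv]
    exact (hb.pow 2).mul_const _
  exact (hg.add h1).add h2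

lemma integrableOn_of_abs_le (hS : IsCompact S) {f : (Fin d → ℝ) → ℝ} {C : ℝ}
    (hf : AEStronglyMeasurable f (volume.restrict S)) (hC : ∀ x ∈ S, |f x| ≤ C) :
    IntegrableOn f S := by
  have : IsFiniteMeasure (volume.restrict S) := ⟨by
    rw [Measure.restrict_apply_univ]
    exact hS.measure_lt_top⟩
  exact Integrable.of_bound hf C ((ae_restrict_mem hS.measurableSet).mono hC)

/-- Dominated convergence with a constant majorant, integrable because compact sets have finite
volume. The bound is asked only for `m ≥ 1`, where the Poisson moment estimates hold. -/
lemma tendsto_setIntegral_of_abs_le (hS : IsCompact S) {f : ℕ → (Fin d → ℝ) → ℝ}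
    {g : (Fin d → ℝ) → ℝ} {C : ℝ} (hf : ∀ m, AEStronglyMeasurable (f m) (volume.restrict S))
    (hC : ∀ x ∈ S, ∀ m, 1 ≤ m → |f m x| ≤ C)
    (hlim : ∀ x ∈ S, Tendsto (fun m => f m x) atTop (𝓝 (g x))) :
    Tendsto (fun m => ∫ x in S, f m x) atTop (𝓝 (∫ x in S, g x)) := by
  refine tendsto_integral_filter_of_dominated_convergence (fun _ => C)
    (Eventually.of_forall hf) ?_ (integrableOn_of_abs_le hS aestronglyMeasurable_const
      fun _ _ => le_rfl) ((ae_restrict_mem hS.measurableSet).mono hlim)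
  filter_upwards [eventually_ge_atTop 1] with m hm
  exact (ae_restrict_mem hS.measurableSet).mono fun x hx => hC x hx m hm

variable {Ω : Type*} [MeasurableSpace Ω] {P : Measure Ω} [IsProbabilityMeasure P]
  {μ : Measure (Fin d → ℝ)} {X : ℕ → Ω → Fin d → ℝ} {m : ℕ → ℕ}

lemma imse_empiricalCdf (hlaw : ∀ i, HasLaw (X i) μ P) (hindep : iIndepFun X P) {n : ℕ}
    (hn : 1 ≤ n) :
    imse P S (empiricalCdf X n) (distFun μ) = (∫ x in S, sigmaSq (distFun μ) x) / n := by
  rw [imse, ← integral_div]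
  simp_rw [mse_empiricalCdf hlaw hindep hn]

variable [IsProbabilityMeasure μ]

lemma abs_distFun_le_one (x : Fin d → ℝ) : |distFun μ x| ≤ 1 := by
  rw [distFun, abs_of_nonneg measureReal_nonneg]
  exact measureReal_le_one

theorem localDeficiency_expansions (hlaw : ∀ i, HasLaw (X i) μ P) (hindep : iIndepFun X P)
    (hF : ContDiffOn ℝ 2 (distFun μ) (posOrthant d)) {x : Fin d → ℝ} (hx : x ∈ posOrthant d)
    (hs : 0 < sigmaSq (distFun μ) x) (hm : ∀ n, 1 ≤ m n) :
    DeficiencyExpansions (fun n => localDeficiency P X (distFun μ) (m n) n x) m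
      (sigmaSq (distFun μ) x) (V (distFun μ) x) (B (distFun μ) x ^ 2) := by
  refine deficiencyExpansions_of_error
    (A := fun n => mse P (estimator X (fun _ => m n) n x) (distFun μ x)) hs hm (fun n => ?_)
    (tendsto_varianceGain hF abs_distFun_le_one hx)
    ((tendsto_scaledBias hF abs_distFun_le_one hx).pow 2)
    fun n hn => mul_mse_estimator hlaw hindep hn (hm n) hx
  rw [localDeficiency]
  congr 1
  ext k
  exact and_congr_right fun hk => by rw [mse_empiricalCdf hlaw hindep hk]

lemma mul_imse_estimator (hlaw : ∀ i, HasLaw (X i) μ P) (hindep : iIndepFun X P)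
    (hF : ContDiffOn ℝ 2 (distFun μ) (posOrthant d)) (hS : IsCompact S)
    (hSpos : S ⊆ posOrthant d) {n m : ℕ} (hn : 1 ≤ n) (hm : 1 ≤ m) :
    n * imse P S (estimator X (fun _ => m) n) (distFun μ) =
      (∫ x in S, sigmaSq (distFun μ) x) -
        (∫ x in S, varianceGain (distFun μ) m x) / Real.sqrt m +
        n * (∫ x in S, scaledBias (distFun μ) m x ^ 2) / (m : ℝ) ^ 2 := by
  have hF1 : ∀ x, |distFun μ x| ≤ 1 := abs_distFun_le_one
  obtain ⟨C₁, h1⟩ := exists_abs_varianceGain_le hF hF1 hS hSpos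
  obtain ⟨C₂, h2⟩ := exists_abs_scaledBias_le hF hF1 hS hSpos
  have hFc := hF.continuousOn.mono hSpos
  have i0 : IntegrableOn (fun x => sigmaSq (distFun μ) x) S :=
    (hFc.mul (continuousOn_const.sub hFc)).integrableOn_compact hS
  have i1 : IntegrableOn (fun x => varianceGain (distFun μ) m x / Real.sqrt m) S :=
    (integrableOn_of_abs_le hS (aestronglyMeasurable_varianceGain hF hF1 m hS.measurableSet hSpos)
      fun x hx => h1 x hx m hm).div_const _
  have i2 : IntegrableOn (fun x => n * scaledBias (distFun μ) m x ^ 2 / (m : ℝ) ^ 2) S := by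
    refine Integrable.div_const (Integrable.const_mul ?_ _) _
    refine integrableOn_of_abs_le (C := C₂ ^ 2) hS
      ((aestronglyMeasurable_scaledBias hF hF1 m hS.measurableSet hSpos).pow 2) fun x hx => ?_
    rw [abs_pow]
    gcongr
    exact h2 x hx m hm
  have i3 : IntegrableOn (fun x => sigmaSq (distFun μ) x -
    varianceGain (distFun μ) m x / Real.sqrt m) S := i0.sub i1
  rw [imse, ← integral_const_mul, setIntegral_congr_fun hS.measurableSet fun x hx =>
    mul_mse_estimator hlaw hindep hn hm (hSpos hx), integral_add i3 i2, integral_sub i0 i1,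
    integral_div, integral_div, integral_const_mul]

theorem globalDeficiency_expansions (hlaw : ∀ i, HasLaw (X i) μ P) (hindep : iIndepFun X P)
    (hF : ContDiffOn ℝ 2 (distFun μ) (posOrthant d)) (hS : IsCompact S)
    (hSpos : S ⊆ posOrthant d) (hs : 0 < ∫ x in S, sigmaSq (distFun μ) x)
    (hm : ∀ n, 1 ≤ m n) :
    DeficiencyExpansions (fun n => globalDeficiency P X (distFun μ) (m n) n S) m
      (∫ x in S, sigmaSq (distFun μ) x) (∫ x in S, V (distFun μ) x)
      (∫ x in S, B (distFun μ) x ^ 2) := by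
  have hF1 : ∀ x, |distFun μ x| ≤ 1 := abs_distFun_le_one
  obtain ⟨C₁, h1⟩ := exists_abs_varianceGain_le hF hF1 hS hSpos
  obtain ⟨C₂, h2⟩ := exists_abs_scaledBias_le hF hF1 hS hSpos
  refine deficiencyExpansions_of_error
    (A := fun n => imse P S (estimator X (fun _ => m n) n) (distFun μ)) hs hm (fun n => ?_)
    (tendsto_setIntegral_of_abs_le hS
      (fun k => aestronglyMeasurable_varianceGain hF hF1 k hS.measurableSet hSpos) h1
      fun x hx => tendsto_varianceGain hF hF1 (hSpos hx))
    (tendsto_setIntegral_of_abs_le (f := fun k x => scaledBias (distFun μ) k x ^ 2) (C := C₂ ^ 2) hS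
      (fun k => (aestronglyMeasurable_scaledBias hF hF1 k hS.measurableSet hSpos).pow 2)
      (fun x hx k hk => ?_)
      fun x hx => (tendsto_scaledBias hF hF1 (hSpos hx)).pow 2)
    fun n hn => mul_imse_estimator hlaw hindep hF hS hSpos hn (hm n)
  · rw [globalDeficiency]
    congr 1
    ext k
    exact and_congr_right fun hk => by rw [imse_empiricalCdf hlaw hindep hk]
  · rw [abs_pow]
    gcongr
    exact h2 x hx k hk

end LocalGlobal

end SzaszMirakyan

open SzaszMirakyan in
theorem mainTheorem3 {d : ℕ} {Ω : Type*} [MeasurableSpace Ω]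
    (P : Measure Ω) [IsProbabilityMeasure P]
    (μ : Measure (Fin d → ℝ)) [IsProbabilityMeasure μ]
    (hsupp : ∀ᵐ y ∂μ, ∀ j, 0 ≤ y j)
    (X : ℕ → Ω → Fin d → ℝ)
    (hlaw : ∀ i, HasLaw (X i) μ P) (hindep : iIndepFun X P)
    (hF : RegularC2 (distFun μ))
    (S : Set (Fin d → ℝ)) (hS : IsCompact S) (hSpos : S ⊆ posOrthant d)
    (m : ℕ → ℕ) (hm : ∀ n, 1 ≤ m n) :
    (∀ x ∈ S, 0 < distFun μ x → distFun μ x < 1 →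
      DeficiencyExpansions
        (fun n => localDeficiency P X (distFun μ) (m n) n x) m
        (sigmaSq (distFun μ) x)
        (V (distFun μ) x)
        (B (distFun μ) x ^ 2)) ∧
    (0 < ∫ x in S, sigmaSq (distFun μ) x →
      DeficiencyExpansions
        (fun n => globalDeficiency P X (distFun μ) (m n) n S) m
        (∫ x in S, sigmaSq (distFun μ) x)
        (∫ x in S, V (distFun μ) x)
        (∫ x in S, B (distFun μ) x ^ 2)) := by
  refine ⟨fun x hx h0 h1 => ?_, fun hs => ?_⟩
  · exact localDeficiency_expansions hlaw hindep hF.1 (hSpos hx)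
      (mul_pos h0 (sub_pos.2 h1)) hm
  · exact globalDeficiency_expansions hlaw hindep hF.1 hS hSpos hs hm
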